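/- Let $(E,\|\cdot\|_E)$ and $(F,\|\cdot\|_F)$ be real Banach spaces, $y_0\in F$, $R>0$, let $B:=\{y\in F:\|y-y_0\|_F<R\}$, and let $f\colon E\times B\to F$ be a map such that $\widetilde f(y):=f(\cdot,y)\colon E\to F$ is continuous and linear for each $y\in B$ and $\widetilde f\colon B\to(\mathcal L(E,F),\|\cdot\|_{\mathrm{op}})$ is Lipschitz with constant $L\in[0,\infty[$. Put $\|\widetilde f\|_\infty:=\sup\{\|\widetilde f(y)\|_{\mathrm{op}}:y\in B\}<\infty$. Notation. For $a<b$, let $\mathcal M([a,b],E)$ be the space of all $\sigma$-additive $E$-valued Borel measures $\mu$ on $[a,b]$ of bounded variation which are of the form $\mu=\rho\,d\nu$ with a finite positive measure $\nu$ and a Bochner integrable function $\rho\in\mathcal L^1(\nu,E)$, and which are non-atomic (there is no Borel set $A$ with $\mu(A)\neq0$ such that $\mu(C)\in\{0,\mu(A)\}$ for all Borel sets $C\subseteq A$). It is normed by the total variation $\|\mu\|:=\mathrm{Var}(\mu)([a,b])$. A function $\gamma\colon[a,b]\to F$ is called a $BV$-function if there is a (necessarily unique) measure $\gamma':=\mu\in\mathcal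 M([a,b],F)$ with $\gamma(x)=\gamma(a)+\mu([a,x])$ for all $x\in[a,b]$; the space $BV([a,b],F)$ of all these functions is normed by $\|\gamma\|_{BV}:=\|\gamma(a)\|_F+\|\gamma'\|$. If $\mu\in\mathcal M([a,b],E)$ and $\gamma\colon[\alpha,\beta]\to B$ is a $BV$-function on an interval $[\alpha,\beta]\subseteq[a,b]$ with $\alpha<\beta$, then $f_*(\mu,\gamma)$ is the $F$-valued measure on $[\alpha,\beta]$ with density $\widetilde f\circ\gamma$ with respect to $\mu|_{[\alpha,\beta]}$, that is, $f_*(\mu,\gamma)(A)=\int_A\widetilde f(\gamma(t))\,d\mu(t)$, the integral being formed by means of the evaluation map $\mathcal L(E,F)\times E\to F$ (if $\mu=\rho\,d\nu$, then $f_*(\mu,\gamma)=f(\rho(t),\gamma(t))\,d\nu(t)$). Such a $\gamma$ is called a $BV$-solution of $y'=f_*(\mu,y)$ if $\gamma'=f_*(\mu,\gamma)$. Finally, for $k\in\mathbb N_0\cup\{\infty\}$, a map $g\colon U\to W$ from an open subset of a normed space $V$ to a normed space $W$ is called $C^k$ (in the sense of Bastiani) if $g$ is continuous and, for all $j\in\mathbb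 N_0$ with $j\le k$, the iterated directional derivatives $d^jg(x,v_1,\dots,v_j)=(D_{v_j}\cdots D_{v_1}g)(x)$ exist for all $x\in U$ and $v_1,\dots,v_j\in V$ and define a continuous map $d^jg\colon U\times V^j\to W$. Then the following holds. (a) For all $a<b$ and $\mu\in\mathcal M([a,b],E)$, the equation $y'=f_*(\mu,y)$ satisfies local uniqueness of $BV$-solutions: if $\gamma_1\colon I_1\to B$ and $\gamma_2\colon I_2\to B$ are $BV$-solutions on non-degenerate compact intervals $I_1,I_2\subseteq[a,b]$ and $\gamma_1(t_0)=\gamma_2(t_0)$ for some $t_0\in I_1\cap I_2$, then $\gamma_1|_K=\gamma_2|_K$ for some neighbourhood $K$ of $t_0$ in $I_1\cap I_2$. (b) For all $a<b$ and each $\mu\in\mathcal M([a,b],E)$ with $L\|\mu\|<1$ and $\|\widetilde f\|_\infty\|\mu\|<R$, and for each $t_0\in[a,b]$, there is a $BV$-solution $\eta_\mu\colon[a,b]\to B$ of $y'=f_*(\mu,y)$ which is defined on all of $[a,b]$ and satisfies $\eta_\mu(t_0)=y_0$. (c) For all $a<b$, the set $Q:=\{\mu\in\mathcal M([a,b],E):\|\widetilde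 f\|_\infty\|\mu\|<R\text{ and }L\|\mu\|<1\}$ is a convex open $0$-neighbourhood in $\mathcal M([a,b],E)$. If $k\in\mathbb N_0\cup\{\infty\}$ and $\widetilde f$ is $C^k$, then for each $t_0\in[a,b]$ the map $Q\to BV([a,b],F)$, $\mu\mapsto\eta_\mu$ is $C^k$. -/

import Mathlib

open MeasureTheory Set Topology
open scoped NNReal ENNReal

namespace BVODE

noncomputable section

/-! ### Vector measures: atoms, densities, the spaces of non-atomic measures -/

section General

variable {X : Type*} [MeasurableSpace X] {E : Type*} [NormedAddCommGroup E] [NormedSpace ℝ E]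

/-- A measurable set `A` is an atom of `μ` if `μ A ≠ 0` and every measurable subset of `A` has
measure `μ A` or `0`. -/
def IsAtom (μ : VectorMeasure X E) (A : Set X) : Prop :=
  MeasurableSet A ∧ μ A ≠ 0 ∧ ∀ B, MeasurableSet B → B ⊆ A → μ B = μ A ∨ μ B = 0

/-- A vector measure without atoms. -/
def IsNonatomic (μ : VectorMeasure X E) : Prop := ∀ A, ¬ IsAtom μ A

/-- `μ = ρ dν` for some finite positive measure `ν` and some Bochner integrable `ρ`. -/
def HasDensity (μ : VectorMeasure X E) : Prop :=
  ∃ (ν : Measure X) (ρ : X → E), IsFiniteMeasure ν ∧ Integrable ρ ν ∧ μ = ν.withDensityᵥ ρ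

theorem HasDensity.zero : HasDensity (0 : VectorMeasure X E) :=
  ⟨0, 0, inferInstance, integrable_zero _ _ _, by simp⟩

theorem HasDensity.smul {μ : VectorMeasure X E} (h : HasDensity μ) (c : ℝ) :
    HasDensity (c • μ) := by
  obtain ⟨ν, ρ, hν, hρ, rfl⟩ := h
  exact ⟨ν, c • ρ, hν, hρ.smul c, by rw [withDensityᵥ_smul]⟩

theorem exists_density_of_ac {ν' ν : Measure X} [IsFiniteMeasure ν'] [IsFiniteMeasure ν]
    (hac : ν' ≪ ν) {ρ : X → E} (hρ : Integrable ρ ν') :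
    ∃ ρ' : X → E, Integrable ρ' ν ∧ ν'.withDensityᵥ ρ = ν.withDensityᵥ ρ' := by
  have hint : Integrable (fun x => (ν'.rnDeriv ν x).toReal • ρ x) ν :=
    (integrable_rnDeriv_smul_iff hac).2 hρ
  refine ⟨fun x => (ν'.rnDeriv ν x).toReal • ρ x, hint, ?_⟩
  rw [withDensityᵥ_smul_eq_withDensityᵥ_withDensity'
    (Measure.measurable_rnDeriv ν' ν).aemeasurable (Measure.rnDeriv_lt_top ν' ν) hint,
    Measure.withDensity_rnDeriv_eq ν' ν hac]

theorem HasDensity.add {μ₁ μ₂ : VectorMeasure X E} (h₁ : HasDensity μ₁) (h₂ : HasDensity μ₂) :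
    HasDensity (μ₁ + μ₂) := by
  obtain ⟨ν₁, ρ₁, hν₁, hρ₁, rfl⟩ := h₁
  obtain ⟨ν₂, ρ₂, hν₂, hρ₂, rfl⟩ := h₂
  have ac₁ : ν₁ ≪ ν₁ + ν₂ := Measure.AbsolutelyContinuous.rfl.add_right ν₂
  have ac₂ : ν₂ ≪ ν₁ + ν₂ := by
    rw [add_comm]; exact Measure.AbsolutelyContinuous.rfl.add_right ν₁
  obtain ⟨r₁, hr₁, e₁⟩ := exists_density_of_ac ac₁ hρ₁
  obtain ⟨r₂, hr₂, e₂⟩ := exists_density_of_ac ac₂ hρ₂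
  exact ⟨ν₁ + ν₂, r₁ + r₂, inferInstance, hr₁.add hr₂, by rw [e₁, e₂, withDensityᵥ_add hr₁ hr₂]⟩

/-- On a countably generated space whose points are measurable, non-atomic means that singletons
are null sets. -/
theorem isNonatomic_iff [MeasurableSpace.CountablyGenerated X] [MeasurableSpace.SeparatesPoints X]
    [MeasurableSingletonClass X] (μ : VectorMeasure X E) :
    IsNonatomic μ ↔ ∀ x, μ {x} = 0 := by
  constructor
  · intro h x
    by_contra hx
    refine h {x} ⟨measurableSet_singleton x, hx, fun B _ hB => ?_⟩
    rcases subset_singleton_iff_eq.1 hB with rfl | rfl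
    · exact Or.inr μ.empty
    · exact Or.inl rfl
  · rintro h A ⟨hA, hA0, hsub⟩
    let S : ℕ → Set X := fun n => {x | MeasurableSpace.mapNatBool X x n = true}
    have hS : ∀ n, MeasurableSet (S n) := fun n =>
      (measurable_pi_apply n).comp (MeasurableSpace.measurable_mapNatBool X)
        (measurableSet_singleton true)
    have step : ∀ (n : ℕ) (B : {B : Set X // MeasurableSet B ∧ B ⊆ A ∧ μ B = μ A}),
        ∃ C : {B : Set X // MeasurableSet B ∧ B ⊆ A ∧ μ B = μ A},
          C.1 ⊆ B.1 ∧ (C.1 ⊆ S n ∨ C.1 ⊆ (S n)ᶜ) := by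
      rintro n ⟨B, hB, hBA, hBμ⟩
      rcases hsub (B ∩ S n) (hB.inter (hS n)) (inter_subset_left.trans hBA) with h1 | h1
      · exact ⟨⟨B ∩ S n, hB.inter (hS n), inter_subset_left.trans hBA, h1⟩, inter_subset_left,
          Or.inl inter_subset_right⟩
      · refine ⟨⟨B \ S n, hB.diff (hS n), diff_subset.trans hBA, ?_⟩, diff_subset,
          Or.inr fun x hx => hx.2⟩
        have := VectorMeasure.of_union (v := μ) (disjoint_sdiff_inter (s := B) (t := S n))
          (hB.diff (hS n)) (hB.inter (hS n))
        rw [diff_union_inter, h1, add_zero, hBμ] at this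
        exact this.symm
    choose T hT1 hT2 using step
    let B : ℕ → {B : Set X // MeasurableSet B ∧ B ⊆ A ∧ μ B = μ A} := fun n =>
      Nat.rec ⟨A, hA, Subset.rfl, rfl⟩ (fun m C => T m C) n
    have hanti : Antitone fun n => (B n).1 := antitone_nat_of_succ_le fun n => hT1 n (B n)
    have hlim := VectorMeasure.tendsto_vectorMeasure_iInter_atTop_nat (v := μ) hanti
      (fun n => (B n).2.1)
    have hval : μ (⋂ n, (B n).1) = μ A := by
      refine tendsto_nhds_unique hlim ?_
      have : (fun n => μ (B n).1) = fun _ => μ A := funext fun n => (B n).2.2.2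
      simpa [Function.comp_def, this] using (tendsto_const_nhds : Filter.Tendsto
        (fun _ : ℕ => μ A) Filter.atTop (𝓝 (μ A)))
    have hss : (⋂ n, (B n).1).Subsingleton := by
      intro x hx y hy
      refine MeasurableSpace.injective_mapNatBool X (funext fun n => ?_)
      have hx' : x ∈ (B (n + 1)).1 := mem_iInter.1 hx (n + 1)
      have hy' : y ∈ (B (n + 1)).1 := mem_iInter.1 hy (n + 1)
      rcases hT2 n (B n) with h1 | h1
      · have a1 : MeasurableSpace.mapNatBool X x n = true := h1 hx'
        have a2 : MeasurableSpace.mapNatBool X y n = true := h1 hy'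
        rw [a1, a2]
      · have a1 : ¬ MeasurableSpace.mapNatBool X x n = true := h1 hx'
        have a2 : ¬ MeasurableSpace.mapNatBool X y n = true := h1 hy'
        rw [Bool.not_eq_true] at a1 a2
        rw [a1, a2]
    rcases hss.eq_empty_or_singleton with h1 | ⟨x, h1⟩
    · rw [h1, μ.empty] at hval
      exact hA0 hval.symm
    · rw [h1, h x] at hval
      exact hA0 hval.symm

end General

section Interval

variable (a b : ℝ) (E : Type*) [NormedAddCommGroup E] [NormedSpace ℝ E]

/-- The `E`-valued (countably additive) Borel measures of bounded variation on `[a,b]` which have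
a density with respect to a finite positive measure and are non-atomic. -/
def naMeasSubmodule : Submodule ℝ (VectorMeasure (Icc a b) E) where
  carrier := {μ | μ.variation univ < ∞ ∧ HasDensity μ ∧ IsNonatomic μ}
  zero_mem' := ⟨by simp, HasDensity.zero, fun A h => h.2.1 rfl⟩
  add_mem' := by
    rintro μ₁ μ₂ ⟨v₁, d₁, n₁⟩ ⟨v₂, d₂, n₂⟩
    refine ⟨?_, d₁.add d₂, ?_⟩
    · exact (VectorMeasure.variation_add_le (μ := μ₁) (ν := μ₂) univ).trans_lt
        (by simpa using ENNReal.add_lt_top.2 ⟨v₁, v₂⟩)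
    · rw [isNonatomic_iff] at n₁ n₂ ⊢
      intro x
      simp [n₁ x, n₂ x]
  smul_mem' := by
    rintro c μ ⟨v, d, n⟩
    refine ⟨?_, d.smul c, ?_⟩
    · rw [VectorMeasure.variation_smul]
      simpa using ENNReal.mul_lt_top (by simp) v
    · rw [isNonatomic_iff] at n ⊢
      intro x
      simp [n x]

/-- The space of non-atomic `E`-valued vector measures of bounded variation with density
on `[a,b]`, normed by the total variation. -/
def NAMeas : Type _ := naMeasSubmodule a b E

variable {a b E}

namespace NAMeas

instance : AddCommGroup (NAMeas a b E) := inferInstanceAs (AddCommGroup (naMeasSubmodule a b E))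

instance : Module ℝ (NAMeas a b E) := inferInstanceAs (Module ℝ (naMeasSubmodule a b E))

/-- The underlying vector measure. -/
def toVM (μ : NAMeas a b E) : VectorMeasure (Icc a b) E := Subtype.val μ

theorem toVM_injective : Function.Injective (toVM : NAMeas a b E → _) := Subtype.val_injective

@[simp] theorem toVM_zero : (0 : NAMeas a b E).toVM = 0 := rfl

@[simp] theorem toVM_add (μ ν : NAMeas a b E) : (μ + ν).toVM = μ.toVM + ν.toVM := rfl

@[simp] theorem toVM_smul (c : ℝ) (μ : NAMeas a b E) : (c • μ).toVM = c • μ.toVM := rfl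

theorem variation_lt_top (μ : NAMeas a b E) : μ.toVM.variation univ < ∞ := μ.2.1

/-- The variation norm. -/
instance : Norm (NAMeas a b E) := ⟨fun μ => (μ.toVM.variation univ).toReal⟩

theorem norm_def (μ : NAMeas a b E) : ‖μ‖ = (μ.toVM.variation univ).toReal := rfl

theorem core : NormedSpace.Core ℝ (NAMeas a b E) where
  norm_nonneg μ := ENNReal.toReal_nonneg
  norm_smul c μ := by
    simp [norm_def, VectorMeasure.variation_smul]
  norm_triangle μ ν := by
    rw [norm_def, norm_def, norm_def,
      ← ENNReal.toReal_add μ.variation_lt_top.ne ν.variation_lt_top.ne]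
    refine ENNReal.toReal_mono
      (ENNReal.add_lt_top.2 ⟨μ.variation_lt_top, ν.variation_lt_top⟩).ne ?_
    simpa using VectorMeasure.variation_add_le (μ := μ.toVM) (ν := ν.toVM) univ
  norm_eq_zero_iff μ := by
    constructor
    · intro h
      rw [norm_def, ENNReal.toReal_eq_zero_iff, or_iff_left μ.variation_lt_top.ne,
        Measure.measure_univ_eq_zero, VectorMeasure.variation_eq_zero] at h
      exact toVM_injective h
    · rintro rfl
      simp [norm_def]

instance : NormedAddCommGroup (NAMeas a b E) := NormedAddCommGroup.ofCore core

instance : NormedSpace ℝ (NAMeas a b E) := NormedSpace.ofCore core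

end NAMeas

/-! ### Functions of bounded variation -/

theorem eq_of_Iic [Fact (a < b)] {μ ν : VectorMeasure (Icc a b) E}
    (h : ∀ x, μ (Iic x) = ν (Iic x)) : μ = ν := by
  refine VectorMeasure.ext_of_generateFrom (range Iic) ?_ ?_ isPiSystem_Iic ?_
  · rintro _ ⟨x, rfl⟩
    exact h x
  · rw [← borel_eq_generateFrom_Iic]
    exact BorelSpace.measurable_eq
  · have : (univ : Set (Icc a b)) = Iic ⟨b, right_mem_Icc.2 (Fact.out : a < b).le⟩ := by
      ext x
      exact ⟨fun _ => x.2.2, fun _ => mem_univ x⟩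
    rw [this, h]

variable (a b) in
/-- The left end point of `[a,b]`. -/
def left [h : Fact (a < b)] : Icc a b := ⟨a, left_mem_Icc.2 h.out.le⟩

variable (a b) (F : Type*) [NormedAddCommGroup F] [NormedSpace ℝ F] [Fact (a < b)]

/-- The functions `f : [a,b] → F` for which there is a non-atomic vector measure `μ` of bounded
variation with density such that `f x = f a + μ([a,x])` for all `x`. -/
def bvSubmodule : Submodule ℝ (Icc a b → F) where
  carrier := {f | ∃ μ : NAMeas a b F, ∀ x, f x = f (left a b) + μ.toVM (Iic x)}
  zero_mem' := ⟨0, by simp⟩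
  add_mem' := by
    rintro f g ⟨μ, hμ⟩ ⟨ν, hν⟩
    refine ⟨μ + ν, fun x => ?_⟩
    simp only [Pi.add_apply, NAMeas.toVM_add, add_apply]
    rw [hμ x, hν x]
    abel
  smul_mem' := by
    rintro c f ⟨μ, hμ⟩
    refine ⟨c • μ, fun x => ?_⟩
    simp only [Pi.smul_apply, NAMeas.toVM_smul, smul_apply]
    rw [hμ x, smul_add]

/-- The space of `F`-valued (continuous) functions of bounded variation on `[a,b]`. -/
def BV : Type _ := bvSubmodule a b F

variable {a b F}

namespace BV

instance : AddCommGroup (BV a b F) := inferInstanceAs (AddCommGroup (bvSubmodule a b F))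

instance : Module ℝ (BV a b F) := inferInstanceAs (Module ℝ (bvSubmodule a b F))

/-- The underlying function. -/
def toFun (γ : BV a b F) : Icc a b → F := Subtype.val γ

instance : CoeFun (BV a b F) (fun _ => Icc a b → F) := ⟨toFun⟩

theorem toFun_injective : Function.Injective (toFun : BV a b F → _) := Subtype.val_injective

@[simp] theorem zero_apply (x : Icc a b) : (0 : BV a b F) x = 0 := rfl

@[simp] theorem add_apply (γ η : BV a b F) (x : Icc a b) : (γ + η) x = γ x + η x := rfl

@[simp] theorem smul_apply (c : ℝ) (γ : BV a b F) (x : Icc a b) : (c • γ) x = c • γ x := rfl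

/-- The derivative `γ'`, i.e. the unique measure with `γ x = γ a + γ'([a,x])` for all `x`. -/
def deriv (γ : BV a b F) : NAMeas a b F := Classical.choose γ.2

theorem apply_eq (γ : BV a b F) (x : Icc a b) : γ x = γ (left a b) + γ.deriv.toVM (Iic x) :=
  Classical.choose_spec γ.2 x

theorem deriv_unique (γ : BV a b F) (μ : NAMeas a b F)
    (h : ∀ x, γ x = γ (left a b) + μ.toVM (Iic x)) : γ.deriv = μ :=
  NAMeas.toVM_injective <| eq_of_Iic fun x => by
    have := (γ.apply_eq x).symm.trans (h x)
    exact add_left_cancel this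

theorem deriv_add (γ η : BV a b F) : (γ + η).deriv = γ.deriv + η.deriv := by
  refine deriv_unique _ _ fun x => ?_
  simp only [add_apply, NAMeas.toVM_add, _root_.add_apply]
  rw [γ.apply_eq x, η.apply_eq x]
  abel

theorem deriv_smul (c : ℝ) (γ : BV a b F) : (c • γ).deriv = c • γ.deriv := by
  refine deriv_unique _ _ fun x => ?_
  simp only [smul_apply, NAMeas.toVM_smul, _root_.smul_apply]
  rw [γ.apply_eq x, smul_add]

theorem deriv_zero : (0 : BV a b F).deriv = 0 :=
  deriv_unique _ _ fun x => by simp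

/-- The norm `‖γ‖ = ‖γ a‖ + ‖γ'‖`. -/
instance : Norm (BV a b F) := ⟨fun γ => ‖γ (left a b)‖ + ‖γ.deriv‖⟩

theorem norm_def (γ : BV a b F) : ‖γ‖ = ‖γ (left a b)‖ + ‖γ.deriv‖ := rfl

theorem core : NormedSpace.Core ℝ (BV a b F) where
  norm_nonneg γ := add_nonneg (norm_nonneg _) (norm_nonneg _)
  norm_smul c γ := by
    rw [norm_def, norm_def, deriv_smul, smul_apply, norm_smul, norm_smul, mul_add]
  norm_triangle γ η := by
    rw [norm_def, norm_def, norm_def, deriv_add, add_apply]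
    have h1 := norm_add_le (γ (left a b)) (η (left a b))
    have h2 := norm_add_le γ.deriv η.deriv
    linarith
  norm_eq_zero_iff γ := by
    constructor
    · intro h
      rw [norm_def, add_eq_zero_iff_of_nonneg (norm_nonneg _) (norm_nonneg _), norm_eq_zero,
        norm_eq_zero] at h
      refine toFun_injective (funext fun x => ?_)
      change γ x = 0
      rw [γ.apply_eq x, h.1, h.2]
      simp
    · rintro rfl
      simp [norm_def, deriv_zero]

instance : NormedAddCommGroup (BV a b F) := NormedAddCommGroup.ofCore core

instance : NormedSpace ℝ (BV a b F) := NormedSpace.ofCore core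

end BV

end Interval

/-! ### The measures `f_*(μ,γ)` and differential equations -/

section Equation

variable {E F G : Type*} [NormedAddCommGroup E] [NormedSpace ℝ E]
  [NormedAddCommGroup F] [NormedSpace ℝ F] [NormedAddCommGroup G] [NormedSpace ℝ G]

open Classical in
/-- The continuous linear map `f(·,y) : E → G`
(with value `0` if `f(·,y)` fails to be linear and continuous). -/
def tilde (f : E → F → G) (y : F) : E →L[ℝ] G :=
  if h : IsLinearMap ℝ (fun x => f x y) ∧ Continuous (fun x => f x y) then
    { toLinearMap := IsLinearMap.mk' (fun x => f x y) h.1, cont := h.2 }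
  else 0

/-- The measure `f_*(μ,γ)`, having density `t ↦ f(·,γ t)` with respect to the vector measure `μ`,
by means of the evaluation pairing `L(E,G) × E → G`: it takes a Borel set `A` to
`∫_A f(·,γ t) dμ(t)`. For a simple density `∑ᵢ 1_{Aᵢ} vᵢ` this is `A ↦ ∑ᵢ vᵢ (μ (A ∩ Aᵢ))`. -/
def fStar {X : Type*} [MeasurableSpace X] (f : E → F → G) (μ : VectorMeasure X E) (γ : X → F) :
    VectorMeasure X G :=
  μ.withDensity (fun t => tilde f (γ t)) (ContinuousLinearMap.id ℝ (E →L[ℝ] G))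

theorem measurableEmbedding_incl {α β a b : ℝ} (h : Icc α β ⊆ Icc a b) :
    MeasurableEmbedding (Set.inclusion h) where
  injective := Set.inclusion_injective h
  measurable := (continuous_inclusion h).measurable
  measurableSet_image' := by
    rintro _ ⟨s, hs, rfl⟩
    refine ⟨s ∩ Icc α β, hs.inter measurableSet_Icc, ?_⟩
    ext x
    constructor
    · rintro ⟨h1, h2⟩
      exact ⟨⟨x, h2⟩, h1, rfl⟩
    · rintro ⟨y, hy, rfl⟩
      exact ⟨hy, y.2⟩

open Classical in
/-- The restriction of a vector measure on `[a,b]` to the Borel subsets of `[α,β] ⊆ [a,b]`. -/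
def restrictTo {α β a b : ℝ} (h : Icc α β ⊆ Icc a b) (μ : VectorMeasure (Icc a b) E) :
    VectorMeasure (Icc α β) E where
  measureOf' A := if MeasurableSet A then μ (Set.inclusion h '' A) else 0
  empty' := by simp
  not_measurable' A hA := if_neg hA
  m_iUnion' A hA hd := by
    rw [if_pos (MeasurableSet.iUnion hA), image_iUnion]
    simp only [hA, if_true]
    exact μ.m_iUnion (fun i => (measurableEmbedding_incl h).measurableSet_image.2 (hA i))
      fun i j hij => (disjoint_image_iff (Set.inclusion_injective h)).2 (hd hij)

/-- `γ : [α,β] → U ⊆ F` is a `BV`-solution of `y' = f_*(μ,y)`, where `μ` is a measure on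
`[a,b] ⊇ [α,β]` and `f : E × U → F`. -/
def IsBVSolution {a b α β : ℝ} [Fact (α < β)] (f : E → F → F) (U : Set F) (μ : NAMeas a b E)
    (h : Icc α β ⊆ Icc a b) (γ : BV α β F) : Prop :=
  (∀ t, γ t ∈ U) ∧ γ.deriv.toVM = fStar f (restrictTo h μ.toVM) γ

/-- Local uniqueness of `BV`-solutions of `y' = f_*(μ,y)`: two solutions, on compact
intervals `I₁, I₂ ⊆ [a,b]`, which agree at some `t₀ ∈ I₁ ∩ I₂` agree on a neighbourhood of `t₀`
in `I₁ ∩ I₂`. -/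
def LocallyUniqueBVSolutions {a b : ℝ} (f : E → F → F) (U : Set F) (μ : NAMeas a b E) : Prop :=
  ∀ (α₁ β₁ α₂ β₂ : ℝ) [Fact (α₁ < β₁)] [Fact (α₂ < β₂)]
    (h₁ : Icc α₁ β₁ ⊆ Icc a b) (h₂ : Icc α₂ β₂ ⊆ Icc a b) (γ₁ : BV α₁ β₁ F) (γ₂ : BV α₂ β₂ F),
    IsBVSolution f U μ h₁ γ₁ → IsBVSolution f U μ h₂ γ₂ →
    ∀ (t₀ : ℝ) (ht₁ : t₀ ∈ Icc α₁ β₁) (ht₂ : t₀ ∈ Icc α₂ β₂), γ₁ ⟨t₀, ht₁⟩ = γ₂ ⟨t₀, ht₂⟩ →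
    ∃ K ∈ 𝓝[Icc α₁ β₁ ∩ Icc α₂ β₂] t₀, ∀ (t : ℝ) (hs₁ : t ∈ Icc α₁ β₁) (hs₂ : t ∈ Icc α₂ β₂),
      t ∈ K → γ₁ ⟨t, hs₁⟩ = γ₂ ⟨t, hs₂⟩

/-- The supremum `‖f̃‖_∞` of the operator norms `‖f(·,y)‖` over `y ∈ U`. -/
def tildeSup (f : E → F → G) (U : Set F) : ℝ := sSup ((fun y => ‖tilde f y‖) '' U)

/-- The set of all measures `μ` on `[a,b]` with `‖f̃‖_∞ ‖μ‖ < R` and `L ‖μ‖ < 1`, where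
`‖f̃‖_∞` is the supremum over the ball `B_R(y₀)`. -/
def smallMeasures (a b : ℝ) (f : E → F → F) (y₀ : F) (R : ℝ) (L : ℝ≥0) : Set (NAMeas a b E) :=
  {μ | tildeSup f (Metric.ball y₀ R) * ‖μ‖ < R ∧ (L : ℝ) * ‖μ‖ < 1}

end Equation

/-! ### `C^k`-maps in the sense of Bastiani -/

section Calculus

variable {V W : Type*} [NormedAddCommGroup V] [NormedSpace ℝ V]
  [NormedAddCommGroup W] [NormedSpace ℝ W]

/-- The iterated directional derivative
`d^j f (x, y₁, …, y_j) = (D_{y_j} ⋯ D_{y₁} f)(x)`. -/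
def iterDirDeriv (f : V → W) : (j : ℕ) → V → (Fin j → V) → W
  | 0, x, _ => f x
  | j + 1, x, y => lineDeriv ℝ (fun z => iterDirDeriv f j z (Fin.init y)) x (y (Fin.last j))

/-- `f` is `C^k` on the open set `U`, in the sense of Bastiani (Keller's `C^k_c`): `f` is continuous
on `U`, and for all `j ≤ k` the iterated directional derivatives `d^j f` exist at all points
of `U`, in all directions, and define a continuous map on `U × V^j`. -/
def IsBastianiC (k : ℕ∞) (U : Set V) (f : V → W) : Prop :=
  ContinuousOn f U ∧ ∀ j : ℕ, (j : ℕ∞) ≤ k →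
    (∀ i < j, ∀ x ∈ U, ∀ (y : Fin i → V) (v : V),
      LineDifferentiableAt ℝ (fun z => iterDirDeriv f i z y) x v) ∧
    ContinuousOn (fun p : V × (Fin j → V) => iterDirDeriv f j p.1 p.2) (U ×ˢ univ)

end Calculus

end

end BVODE

open BVODE

/-! A `BV`-solution on [a,b] with value y₀ at t₀ is a fixed point of the Picard operator sending γ
to y₀ plus the primitive, vanishing at t₀, of f_*(μ,γ). The operator is studied on C([a,b],F) with
the supremum norm instead of on `BV`: the density f̃∘γ only needs γ continuous, and superposition
operators behave well there. Non-atomicity of μ means that its variation has no point masses, so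
primitives are indeed continuous. The pairing (A,μ) ↦ A dμ is bilinear of norm at most 1, and so is
passing to primitives a contraction of norms. Hence the Picard operator has Lipschitz constant L‖μ‖
and maps into the closed ball of radius ‖f̃‖_∞‖μ‖ about the constant y₀; Banach's fixed point
theorem gives (b). In (a) the norm of μ need not be small, but the variation of μ is small on small
neighbourhoods of t₀, and the same estimate forces the maximal distance of two solutions there to
vanish.

For (c), the Picard operator is C^k in (μ,γ), being a bounded bilinear map composed with the
superposition operator of f̃. Fixed points of C^k families of uniform contractions are C^k in the
parameter (`BastianiC.fixedPoint`): the derivative of the fixed point is itself the fixed point of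
the linearised contraction, so one can induct on the order. This yields a C^k-map into C([a,b],F);
inserting it once more into γ' = f_*(μ,γ) upgrades the target to `BV`.

Iterated directional derivatives are unsuited to chain rules, so everything is done with the
recursive notion `BastianiC`, whose derivative is taken jointly in point and direction. The two
notions are shown to agree on open sets; passing to the recursive one needs the multilinearity of
d^j f. -/

namespace BVODE

open Filter

universe u

/-! ### Directional derivatives and the recursive form of Bastiani calculus -/

section Calculus

/-- Mean value estimate: parametrised difference quotients of a function with continuous partial
derivative converge to this derivative. -/
theorem tendsto_slope_of_continuousAt {P W : Type*} [TopologicalSpace P]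
    [NormedAddCommGroup W] [NormedSpace ℝ W] {G G' : ℝ → P → W} {p₀ : P} {p : ℝ → P}
    (hG : ∀ᶠ z : ℝ × P in 𝓝 (0, p₀), HasDerivAt (fun s => G s z.2) (G' z.1 z.2) z.1)
    (hG' : ContinuousAt (fun z : ℝ × P => G' z.1 z.2) (0, p₀))
    (hp : Tendsto p (𝓝[≠] 0) (𝓝 p₀)) :
    Tendsto (fun t => t⁻¹ • (G t (p t) - G 0 (p t))) (𝓝[≠] 0) (𝓝 (G' 0 p₀)) := by
  rw [Metric.tendsto_nhds]
  intro ε hε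
  have h1 : ∀ᶠ z : ℝ × P in 𝓝 (0, p₀), dist (G' z.1 z.2) (G' 0 p₀) < ε / 2 :=
    hG'.eventually (Metric.ball_mem_nhds _ (half_pos hε))
  have h2 := hG.and h1
  rw [nhds_prod_eq, Filter.eventually_prod_iff] at h2
  obtain ⟨A, hA, B, hB, hAB⟩ := h2
  obtain ⟨δ, hδ, hδA⟩ := Metric.eventually_nhds_iff_ball.1 hA
  have hball : ∀ᶠ t : ℝ in 𝓝[≠] 0, t ∈ Metric.ball (0 : ℝ) δ :=
    nhdsWithin_le_nhds (Metric.ball_mem_nhds _ hδ)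
  filter_upwards [hp.eventually hB, hball, self_mem_nhdsWithin] with t ht htδ ht0
  have ht0 : t ≠ 0 := ht0
  -- Subtracting the expected linear part s • G'(0,p₀) leaves a function with derivative at most ε/2
  -- near 0, for every parameter near p₀.
  have key := (convex_ball (0 : ℝ) δ).norm_image_sub_le_of_norm_hasDerivWithin_le
    (f := fun s => G s (p t) - s • G' 0 p₀) (f' := fun s => G' s (p t) - G' 0 p₀) (C := ε / 2)
    (fun s hs => by
      have := (hAB (hδA s hs) ht).1.fun_sub ((hasDerivAt_id' s).smul_const (G' 0 p₀))
      rw [one_smul] at this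
      exact this.hasDerivWithinAt)
    (fun s hs => by
      have := (hAB (hδA s hs) ht).2
      rw [dist_eq_norm] at this
      exact this.le)
    (Metric.mem_ball_self hδ) htδ
  have e : t⁻¹ • (G t (p t) - G 0 (p t)) - G' 0 p₀
      = t⁻¹ • ((G t (p t) - t • G' 0 p₀) - (G 0 (p t) - (0 : ℝ) • G' 0 p₀)) := by
    simp only [smul_sub, smul_smul, inv_mul_cancel₀ ht0, zero_smul, one_smul, smul_zero]
    abel
  rw [dist_eq_norm, e, norm_smul, norm_inv]
  have hpos : 0 < ‖t‖ := norm_pos_iff.2 ht0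
  rw [inv_mul_lt_iff₀ hpos]
  simp only [sub_zero] at key
  nlinarith

variable {V W Z : Type*} [NormedAddCommGroup V] [NormedSpace ℝ V] [NormedAddCommGroup W]
  [NormedSpace ℝ W] [NormedAddCommGroup Z] [NormedSpace ℝ Z]

theorem hasLineDerivAt_iff_hasDerivAt {f : V → W} {x v : V} {w : W} {s : ℝ} :
    HasLineDerivAt ℝ f w (x + s • v) v ↔ HasDerivAt (fun r : ℝ => f (x + r • v)) w s := by
  unfold HasLineDerivAt
  have e : (fun t : ℝ => f (x + s • v + t • v)) = fun t => (fun r : ℝ => f (x + r • v)) (s + t) := by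
    funext t
    simp [add_smul, add_assoc]
  rw [e]
  constructor
  · intro h
    have h' : HasDerivAt (fun t => (fun r : ℝ => f (x + r • v)) (s + t)) w (s - s) := by
      simpa using h
    have := h'.comp_sub_const s s
    simpa using this
  · intro h
    have h' : HasDerivAt (fun r : ℝ => f (x + r • v)) w (s + 0) := by simpa using h
    exact h'.comp_const_add s 0

/-- The chain rule along a differentiable path. -/
theorem hasDerivAt_comp_of_hasLineDerivAt {U : Set V} (hU : IsOpen U) {f : V → W}
    {df : V × V → W} (hf : ∀ x ∈ U, ∀ v, HasLineDerivAt ℝ f (df (x, v)) x v)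
    (hdf : ContinuousOn df (U ×ˢ univ)) {c : ℝ → V} {x v : V} (hx : x ∈ U) (hc0 : c 0 = x)
    (hc : HasDerivAt c v 0) : HasDerivAt (fun t => f (c t)) (df (x, v)) 0 := by
  have hcont : ContinuousAt (fun z : ℝ × V => (x + z.1 • z.2, z.2)) (0, v) := by fun_prop
  have hopen : IsOpen (U ×ˢ (univ : Set V)) := hU.prod isOpen_univ
  have hmem : U ×ˢ (univ : Set V) ∈ 𝓝 (x + (0 : ℝ) • v, v) :=
    hopen.mem_nhds ⟨by simpa using hx, mem_univ _⟩
  have hcd : ContinuousAt df (x + (0 : ℝ) • v, v) := hdf.continuousAt hmem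
  rw [hasDerivAt_iff_tendsto_slope_zero] at hc ⊢
  -- Write c(t) = x + t • p(t) with p(t) the difference quotient of c, which tends to v. The path
  -- becomes a straight line whose direction is a convergent parameter.
  have := tendsto_slope_of_continuousAt (G := fun s p => f (x + s • p))
    (G' := fun s p => df (x + s • p, p)) (p₀ := v)
    (p := fun t => t⁻¹ • (c (0 + t) - c 0)) ?_ ?_ hc
  · simp only [zero_smul, add_zero] at this
    refine this.congr' ?_
    filter_upwards [self_mem_nhdsWithin] with t ht
    have ht : t ≠ 0 := ht
    simp only [hc0, zero_add, smul_smul, mul_inv_cancel₀ ht, one_smul, add_sub_cancel]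
  · filter_upwards [hcont.preimage_mem_nhds hmem] with z hz
    exact hasLineDerivAt_iff_hasDerivAt.1 (hf _ hz.1 _)
  · exact ContinuousAt.comp (f := fun z : ℝ × V => (x + z.1 • z.2, z.2)) hcd hcont

/-- A map with continuous directional derivatives has additive directional derivatives. -/
theorem dirDeriv_add {U : Set V} (hU : IsOpen U) {f : V → W}
    {df : V × V → W} (hf : ∀ x ∈ U, ∀ v, HasLineDerivAt ℝ f (df (x, v)) x v)
    (hdf : ∀ v, ContinuousOn (fun x => df (x, v)) U) {x : V} (hx : x ∈ U) (v w : V) :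
    df (x, v + w) = df (x, v) + df (x, w) := by
  have h1 := hasDerivAt_iff_tendsto_slope_zero.1 (hf x hx (v + w))
  have h2 := hasDerivAt_iff_tendsto_slope_zero.1 (hf x hx v)
  have hcont : ContinuousAt (fun z : ℝ × V => z.2 + z.1 • w) (0, x) := by fun_prop
  have hmem : U ∈ 𝓝 (x + (0 : ℝ) • w) := hU.mem_nhds (by simpa using hx)
  -- Go from x to x + t(v + w) via x + tv. The second leg has direction w and the moving base point
  -- x + tv, which is the parameter here.
  have h3 := tendsto_slope_of_continuousAt (G := fun s p => f (p + s • w))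
    (G' := fun s p => df (p + s • w, w)) (p₀ := x) (p := fun t => x + t • v) ?_ ?_ ?_
  · refine tendsto_nhds_unique h1 ?_
    have := h2.add h3
    simp only [zero_smul, add_zero, zero_add] at this
    refine this.congr fun t => ?_
    simp only [zero_add, zero_smul, add_zero, ← smul_add]
    congr 1
    rw [smul_add, ← add_assoc]
    abel
  · filter_upwards [hcont.preimage_mem_nhds hmem] with z hz
    exact hasLineDerivAt_iff_hasDerivAt.1 (hf _ hz _)
  · exact ContinuousAt.comp (f := fun z : ℝ × V => z.2 + z.1 • w)
      (g := fun y => df (y, w)) ((hdf w).continuousAt hmem) hcont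
  · have : ContinuousAt (fun t : ℝ => x + t • v) 0 := by fun_prop
    have := this.tendsto
    simp only [zero_smul, add_zero] at this
    exact this.mono_left nhdsWithin_le_nhds

/-- `C^k`-maps in the sense of Bastiani, described recursively: `f` is `C^{k+1}` on `U` if it
is continuous and its directional derivatives form a `C^k`-map on `U × V`. -/
def BastianiC {W : Type*} [NormedAddCommGroup W] [NormedSpace ℝ W] :
    ℕ → ∀ {V : Type u} [NormedAddCommGroup V] [NormedSpace ℝ V], Set V → (V → W) → Prop
  | 0, _, _, _, U, f => ContinuousOn f U
  | k + 1, V, _, _, U, f => ContinuousOn f U ∧ ∃ df : V × V → W,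
      (∀ x ∈ U, ∀ v, HasLineDerivAt ℝ f (df (x, v)) x v) ∧
        BastianiC k (U ×ˢ (univ : Set V)) df

namespace BastianiC

theorem continuousOn {k : ℕ} {U : Set V} {f : V → W} (h : BastianiC k U f) :
    ContinuousOn f U := by
  cases k with
  | zero => exact h
  | succ k => exact h.1

theorem of_succ {k : ℕ} {V : Type u} [NormedAddCommGroup V] [NormedSpace ℝ V] {U : Set V}
    {f : V → W} (h : BastianiC (k + 1) U f) : BastianiC k U f := by
  induction k generalizing V with
  | zero => exact h.1
  | succ k ih =>
    obtain ⟨h0, df, h1, h2⟩ := h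
    exact ⟨h0, df, h1, ih h2⟩

theorem of_le {k m : ℕ} (hkm : k ≤ m) {U : Set V} {f : V → W} (h : BastianiC m U f) :
    BastianiC k U f := by
  induction hkm with
  | refl => exact h
  | step _ ih => exact ih h.of_succ

theorem mono {k : ℕ} {V : Type u} [NormedAddCommGroup V] [NormedSpace ℝ V] {U U' : Set V}
    {f : V → W} (h : BastianiC k U f) (hU : U' ⊆ U) : BastianiC k U' f := by
  induction k generalizing V with
  | zero => exact ContinuousOn.mono h hU
  | succ k ih =>
    obtain ⟨h0, df, h1, h2⟩ := h
    exact ⟨h0.mono hU, df, fun x hx => h1 x (hU hx), ih h2 (prod_mono hU Subset.rfl)⟩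

theorem congr {k : ℕ} {U : Set V} (hU : IsOpen U)
    {f g : V → W} (h : BastianiC k U f) (hfg : ∀ x ∈ U, g x = f x) : BastianiC k U g := by
  cases k with
  | zero => exact ContinuousOn.congr h hfg
  | succ k =>
    obtain ⟨h0, df, h1, h2⟩ := h
    refine ⟨h0.congr hfg, df, fun x hx v => ?_, h2⟩
    exact (h1 x hx v).congr_of_eventuallyEq (eventually_of_mem (hU.mem_nhds hx) hfg)

theorem prodMk {k : ℕ} {V : Type u} [NormedAddCommGroup V] [NormedSpace ℝ V] {U : Set V}
    {f : V → W} {g : V → Z} (hf : BastianiC k U f) (hg : BastianiC k U g) :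
    BastianiC k U (fun x => (f x, g x)) := by
  induction k generalizing V with
  | zero => exact ContinuousOn.prodMk hf hg
  | succ k ih =>
    obtain ⟨f0, df, f1, f2⟩ := hf
    obtain ⟨g0, dg, g1, g2⟩ := hg
    exact ⟨f0.prodMk g0, fun p => (df p, dg p), fun x hx v =>
      HasDerivAt.prodMk (f1 x hx v) (g1 x hx v), ih f2 g2⟩

theorem of_contDiff {k : ℕ} {V : Type u} [NormedAddCommGroup V] [NormedSpace ℝ V]
    {f : V → W} (hf : ContDiff ℝ k f) (U : Set V) : BastianiC k U f := by
  induction k generalizing V with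
  | zero => exact hf.continuous.continuousOn
  | succ k ih =>
    refine ⟨hf.continuous.continuousOn, fun p => fderiv ℝ f p.1 p.2, fun x _ v => ?_, ?_⟩
    · exact ((hf.differentiable (by simp)) x).hasFDerivAt.hasLineDerivAt v
    · have h1 : ContDiff ℝ k (fderiv ℝ f) := hf.fderiv_right (by simp)
      exact ih ((h1.comp contDiff_fst).clm_apply contDiff_snd) _

/-- The derivative is df ∘ (T × T), again a precomposition with a continuous linear map, so the
induction needs neither the general chain rule nor open domains. -/
theorem comp_clm {k : ℕ} {V V' : Type*} [NormedAddCommGroup V] [NormedSpace ℝ V]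
    [NormedAddCommGroup V'] [NormedSpace ℝ V'] {U : Set V} {U' : Set V'} {f : V' → W}
    (hf : BastianiC k U' f) (T : V →L[ℝ] V') (hT : MapsTo T U U') :
    BastianiC k U (fun x => f (T x)) := by
  induction k generalizing V V' with
  | zero => exact ContinuousOn.comp hf T.continuous.continuousOn hT
  | succ k ih =>
    obtain ⟨f0, df, f1, f2⟩ := hf
    refine ⟨f0.comp T.continuous.continuousOn hT, fun p => df (T p.1, T p.2), fun x hx v => ?_, ?_⟩
    · have := f1 (T x) (hT hx) (T v)
      unfold HasLineDerivAt at this ⊢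
      simpa using this
    · exact ih f2 (T.prodMap T) fun p hp => ⟨hT hp.1, mem_univ _⟩

/-- The derivative (x,v) ↦ dg(f(x), df(x,v)) is again a composition, of dg with (f ∘ fst, df), and
both have one order less to verify. -/
theorem comp {k : ℕ} {W : Type*} [NormedAddCommGroup W] [NormedSpace ℝ W]
    {V : Type u} [NormedAddCommGroup V] [NormedSpace ℝ V] {U : Set V} {U' : Set W}
    (hU : IsOpen U) (hU' : IsOpen U') {g : W → Z} {f : V → W} (hg : BastianiC k U' g)
    (hf : BastianiC k U f) (hfU : MapsTo f U U') : BastianiC k U (fun x => g (f x)) := by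
  induction k generalizing V W with
  | zero => exact ContinuousOn.comp hg hf hfU
  | succ k ih =>
    have hfk := hf.of_succ
    obtain ⟨f0, df, f1, f2⟩ := hf
    obtain ⟨g0, dg, g1, g2⟩ := hg
    refine ⟨g0.comp f0 hfU, fun p => dg (f p.1, df p), fun x hx v => ?_, ?_⟩
    · exact hasDerivAt_comp_of_hasLineDerivAt hU' g1 g2.continuousOn (hfU hx) (by simp)
        (f1 x hx v)
    · refine ih (hU.prod isOpen_univ) (hU'.prod isOpen_univ) g2 (f := fun p => (f p.1, df p))
        (prodMk ?_ f2) fun p hp => ⟨hfU hp.1, mem_univ _⟩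
      exact comp_clm hfk (ContinuousLinearMap.fst ℝ V V) fun p hp => hp.1

theorem contDiff_comp {k : ℕ} {U : Set V} (hU : IsOpen U) {g : W → Z} {f : V → W}
    (hg : ContDiff ℝ k g) (hf : BastianiC k U f) : BastianiC k U (fun x => g (f x)) :=
  comp hU isOpen_univ (of_contDiff hg univ) hf (mapsTo_univ _ _)

theorem sum {k : ℕ} {U : Set V} (hU : IsOpen U) {ι : Type*} (s : Finset ι) {f : ι → V → W}
    (hf : ∀ i ∈ s, BastianiC k U (f i)) : BastianiC k U (fun x => ∑ i ∈ s, f i x) := by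
  classical
  induction s using Finset.induction_on with
  | empty => simpa using of_contDiff contDiff_const U
  | insert i s hi ih =>
    simp only [Finset.sum_insert hi]
    exact contDiff_comp hU (contDiff_fst.add contDiff_snd)
      ((hf i (Finset.mem_insert_self i s)).prodMk
        (ih fun j hj => hf j (Finset.mem_insert_of_mem hj)))

end BastianiC

end Calculus

/-! ### Equivalence of the recursive and the iterated-derivative definitions -/

section Conversion

variable {V W : Type*} [NormedAddCommGroup V] [NormedSpace ℝ V] [NormedAddCommGroup W]
  [NormedSpace ℝ W]

/-- The projection `(x, y) ↦ ((x, Fin.init y), (y (Fin.last n), 0))`. -/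
def initLastCLM (V : Type*) [NormedAddCommGroup V] [NormedSpace ℝ V] (n : ℕ) :
    V × (Fin (n + 1) → V) →L[ℝ] (V × (Fin n → V)) × (V × (Fin n → V)) where
  toFun p := ((p.1, Fin.init p.2), (p.2 (Fin.last n), 0))
  map_add' p q := by ext <;> simp [Fin.init]
  map_smul' c p := by ext <;> simp [Fin.init]
  cont := by
    unfold Fin.init
    fun_prop

/-- The map `((x, y), (v, w)) ↦ (x, Fin.snoc y v)`. -/
def snocCLM (V : Type*) [NormedAddCommGroup V] [NormedSpace ℝ V] (n : ℕ) :
    (V × (Fin n → V)) × (V × (Fin n → V)) →L[ℝ] V × (Fin (n + 1) → V) where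
  toFun p := (p.1.1, Fin.snoc (α := fun _ => V) p.1.2 p.2.1)
  map_add' p q := by
    ext i
    · simp
    · refine Fin.lastCases ?_ (fun i => ?_) i <;> simp
  map_smul' c p := by
    ext i
    · simp
    · refine Fin.lastCases ?_ (fun i => ?_) i <;> simp
  cont := by
    refine Continuous.prodMk (by fun_prop) (continuous_pi fun i => ?_)
    refine Fin.lastCases ?_ (fun i => ?_) i
    · simp only [Fin.snoc_last]; fun_prop
    · simp only [Fin.snoc_castSucc]; fun_prop

/-- The map `((x, y), (v, w)) ↦ (x, Function.update y i (w i))`. -/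
def updateCLM (V : Type*) [NormedAddCommGroup V] [NormedSpace ℝ V] {n : ℕ} (i : Fin n) :
    (V × (Fin n → V)) × (V × (Fin n → V)) →L[ℝ] V × (Fin n → V) where
  toFun p := (p.1.1, Function.update p.1.2 i (p.2.2 i))
  map_add' p q := by
    ext j
    · simp
    · by_cases h : j = i
      · subst h; simp
      · simp [h]
  map_smul' c p := by
    ext j
    · simp
    · by_cases h : j = i
      · subst h; simp
      · simp [h]
  cont := by
    refine Continuous.prodMk (by fun_prop) ?_
    exact Continuous.update (by fun_prop) i (by fun_prop)

theorem iterDirDeriv_succ (f : V → W) (j : ℕ) (x : V) (y : Fin (j + 1) → V) :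
    iterDirDeriv f (j + 1) x y
      = lineDeriv ℝ (fun z => iterDirDeriv f j z (Fin.init y)) x (y (Fin.last j)) := rfl

theorem iterDirDeriv_snoc (f : V → W) (j : ℕ) (x : V) (y : Fin j → V) (v : V) :
    iterDirDeriv f (j + 1) x (Fin.snoc (α := fun _ => V) y v)
      = lineDeriv ℝ (fun z => iterDirDeriv f j z y) x v := by
  rw [iterDirDeriv_succ, Fin.init_snoc, Fin.snoc_last]

namespace BastianiC

/-- Differentiating (x,y) ↦ d^i f(x,y) in a direction (v,0) gives d^{i+1} f, so the latter is the
joint derivative of d^i f precomposed with a linear map. Each step costs one order of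
differentiability. -/
theorem iterDirDeriv {U : Set V} (hU : IsOpen U) {f : V → W} (i : ℕ) :
    ∀ {n : ℕ}, BastianiC (n + i) U f →
      BastianiC n (U ×ˢ univ) (fun p : V × (Fin i → V) => BVODE.iterDirDeriv f i p.1 p.2) := by
  induction i with
  | zero =>
    intro n h
    exact comp_clm (V := V × (Fin 0 → V)) h (ContinuousLinearMap.fst ℝ V (Fin 0 → V))
      fun p hp => hp.1
  | succ i ih =>
    intro n h
    have h' : BastianiC (n + 1 + i) U f := by rwa [add_assoc, add_comm 1 i]
    obtain ⟨-, d, h1, h2⟩ := ih h'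
    refine (comp_clm (U := U ×ˢ univ) h2 (initLastCLM V i)
      fun p hp => ⟨⟨hp.1, mem_univ _⟩, mem_univ _⟩).congr (hU.prod isOpen_univ) fun p hp => ?_
    have := h1 (p.1, Fin.init p.2) ⟨hp.1, mem_univ _⟩ (p.2 (Fin.last i), 0)
    rw [iterDirDeriv_succ]
    refine HasLineDerivAt.lineDeriv ?_
    unfold HasLineDerivAt at this ⊢
    simpa [initLastCLM] using this

theorem lineDifferentiableAt_iterDirDeriv {U : Set V} (hU : IsOpen U) {f : V → W} {i : ℕ}
    (h : BastianiC (i + 1) U f) {x : V} (hx : x ∈ U) (y : Fin i → V) (v : V) :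
    LineDifferentiableAt ℝ (fun z => BVODE.iterDirDeriv f i z y) x v := by
  rw [add_comm] at h
  obtain ⟨-, d, h1, -⟩ := iterDirDeriv hU i h
  have := h1 (x, y) ⟨hx, mem_univ _⟩ (v, 0)
  refine HasLineDerivAt.lineDifferentiableAt (f' := d ((x, y), (v, 0))) ?_
  unfold HasLineDerivAt at this ⊢
  simpa using this

theorem isBastianiC {k : ℕ∞} {U : Set V} (hU : IsOpen U) {f : V → W}
    (h : ∀ n : ℕ, (n : ℕ∞) ≤ k → BastianiC n U f) : IsBastianiC k U f := by
  refine ⟨(h 0 (by simp)).continuousOn, fun j hj => ⟨fun i hi x hx y v => ?_, ?_⟩⟩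
  · exact lineDifferentiableAt_iterDirDeriv hU ((h j hj).of_le hi) hx y v
  · have hj' := h j hj
    rw [← zero_add j] at hj'
    exact (iterDirDeriv hU j hj').continuousOn

end BastianiC

namespace IsBastianiC

variable {k : ℕ∞} {U : Set V} {f : V → W}

theorem of_le {m : ℕ∞} (h : IsBastianiC k U f) (hm : m ≤ k) : IsBastianiC m U f :=
  ⟨h.1, fun j hj => h.2 j (hj.trans hm)⟩

theorem hasLineDerivAt (h : IsBastianiC k U f) {j : ℕ} (hj : ((j + 1 : ℕ) : ℕ∞) ≤ k) {x : V}
    (hx : x ∈ U) (y : Fin j → V) (v : V) :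
    HasLineDerivAt ℝ (fun z => iterDirDeriv f j z y)
      (iterDirDeriv f (j + 1) x (Fin.snoc (α := fun _ => V) y v)) x v := by
  rw [iterDirDeriv_snoc]
  exact ((h.2 (j + 1) hj).1 j (Nat.lt_succ_self j) x hx y v).hasLineDerivAt

theorem continuousOn_left (h : IsBastianiC k U f) {j : ℕ} (hj : (j : ℕ∞) ≤ k) (y : Fin j → V) :
    ContinuousOn (fun x => iterDirDeriv f j x y) U :=
  (h.2 j hj).2.comp (f := fun x => (x, y)) (by fun_prop) fun x hx => ⟨hx, mem_univ _⟩

theorem iterDirDeriv_update_add (hU : IsOpen U) (h : IsBastianiC k U f) {j : ℕ}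
    (hj : (j : ℕ∞) ≤ k) {x : V} (hx : x ∈ U) (y : Fin j → V) (i : Fin j) (v w : V) :
    iterDirDeriv f j x (Function.update y i (v + w))
      = iterDirDeriv f j x (Function.update y i v)
        + iterDirDeriv f j x (Function.update y i w) := by
  induction j generalizing x with
  | zero => exact i.elim0
  | succ j ih =>
    have hj' : (j : ℕ∞) ≤ k := le_trans (by exact_mod_cast Nat.le_succ j) hj
    -- The last direction is the one differentiated last, where `dirDeriv_add` applies. In an
    -- earlier slot, additivity of d^j f holds at all points near x by induction and survives one
    -- further differentiation.
    obtain ⟨i, rfl⟩ | rfl := i.eq_castSucc_or_eq_last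
    swap
    · simp only [iterDirDeriv_succ, Fin.init_update_last, Function.update_self]
      simp only [← iterDirDeriv_snoc]
      exact dirDeriv_add (f := fun z => iterDirDeriv f j z (Fin.init y))
        (df := fun p => iterDirDeriv f (j + 1) p.1
          (Fin.snoc (α := fun _ => V) (Fin.init y) p.2)) hU
        (fun z hz u => h.hasLineDerivAt hj hz (Fin.init y) u)
        (fun u => h.continuousOn_left hj (Fin.snoc (α := fun _ => V) (Fin.init y) u)) hx v w
    · simp only [iterDirDeriv_succ, Fin.init_update_castSucc]
      have e : ∀ u : V, Function.update y i.castSucc u (Fin.last j) = y (Fin.last j) := fun u =>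
        Function.update_of_ne (Fin.castSucc_lt_last i).ne' _ _
      simp only [e]
      have h1 := h.hasLineDerivAt hj hx (Function.update (Fin.init y) i v) (y (Fin.last j))
      have h2 := h.hasLineDerivAt hj hx (Function.update (Fin.init y) i w) (y (Fin.last j))
      have h3 := HasDerivAt.fun_add h1 h2
      rw [h1.lineDeriv, h2.lineDeriv]
      refine HasLineDerivAt.lineDeriv (HasLineDerivAt.congr_of_eventuallyEq (𝕜 := ℝ)
        (f := fun z => iterDirDeriv f j z (Function.update (Fin.init y) i v)
          + iterDirDeriv f j z (Function.update (Fin.init y) i w)) h3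
        (eventually_of_mem (hU.mem_nhds hx) fun z hz => ih hj' hz _ _))

theorem iterDirDeriv_update_smul (hU : IsOpen U) (h : IsBastianiC k U f) {j : ℕ}
    (hj : (j : ℕ∞) ≤ k) {x : V} (hx : x ∈ U) (y : Fin j → V) (i : Fin j) (c : ℝ) (v : V) :
    iterDirDeriv f j x (Function.update y i (c • v))
      = c • iterDirDeriv f j x (Function.update y i v) := by
  induction j generalizing x with
  | zero => exact i.elim0
  | succ j ih =>
    have hj' : (j : ℕ∞) ≤ k := le_trans (by exact_mod_cast Nat.le_succ j) hj
    obtain ⟨i, rfl⟩ | rfl := i.eq_castSucc_or_eq_last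
    swap
    · simp only [iterDirDeriv_succ, Fin.init_update_last, Function.update_self]
      exact lineDeriv_smul
    · simp only [iterDirDeriv_succ, Fin.init_update_castSucc]
      have e : ∀ u : V, Function.update y i.castSucc u (Fin.last j) = y (Fin.last j) := fun u =>
        Function.update_of_ne (Fin.castSucc_lt_last i).ne' _ _
      simp only [e]
      have h1 := h.hasLineDerivAt hj hx (Function.update (Fin.init y) i v) (y (Fin.last j))
      have h3 := HasDerivAt.fun_const_smul c h1
      rw [h1.lineDeriv]
      refine HasLineDerivAt.lineDeriv (HasLineDerivAt.congr_of_eventuallyEq (𝕜 := ℝ)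
        (f := fun z => c • iterDirDeriv f j z (Function.update (Fin.init y) i v)) h3
        (eventually_of_mem (hU.mem_nhds hx) fun z hz => ih hj' hz _ _))

/-- The iterated directional derivative at a point as a continuous multilinear map. -/
noncomputable def multilinear (hU : IsOpen U) (h : IsBastianiC k U f) {j : ℕ}
    (hj : (j : ℕ∞) ≤ k) {x : V} (hx : x ∈ U) :
    ContinuousMultilinearMap ℝ (fun _ : Fin j => V) W where
  toFun := iterDirDeriv f j x
  map_update_add' := by
    intro inst y i v w
    obtain rfl : inst = instDecidableEqFin j := Subsingleton.elim _ _
    exact h.iterDirDeriv_update_add hU hj hx y i v w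
  map_update_smul' := by
    intro inst y i c v
    obtain rfl : inst = instDecidableEqFin j := Subsingleton.elim _ _
    exact h.iterDirDeriv_update_smul hU hj hx y i c v
  cont := by
    change Continuous (iterDirDeriv f j x)
    rw [← continuousOn_univ]
    exact (h.2 j hj).2.comp (f := fun y => (x, y)) (by fun_prop) fun y _ => ⟨hx, mem_univ _⟩

/-- The directional derivatives of `(x, y) ↦ d^j f(x, y)`. -/
theorem hasLineDerivAt_iterDirDeriv (hU : IsOpen U) (h : IsBastianiC k U f) {j : ℕ}
    (hj : ((j + 1 : ℕ) : ℕ∞) ≤ k) {x : V} (hx : x ∈ U) (y : Fin j → V) (v : V) (w : Fin j → V) :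
    HasLineDerivAt ℝ (fun p : V × (Fin j → V) => iterDirDeriv f j p.1 p.2)
      (iterDirDeriv f (j + 1) x (Fin.snoc (α := fun _ => V) y v)
        + ∑ i, iterDirDeriv f j x (Function.update y i (w i))) (x, y) (v, w) := by
  have hj' : (j : ℕ∞) ≤ k := le_trans (by exact_mod_cast Nat.le_succ j) hj
  have hlin := ((h.multilinear hU hj' hx).hasFDerivAt y).hasLineDerivAt w
  rw [ContinuousMultilinearMap.linearDeriv_apply] at hlin
  have hlin' := hasDerivAt_iff_tendsto_slope_zero.1 hlin
  have hcont : ContinuousAt (fun z : ℝ × (Fin j → V) => x + z.1 • v) (0, y) := by fun_prop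
  have hmem : U ∈ 𝓝 (x + (0 : ℝ) • v) := hU.mem_nhds (by simpa using hx)
  -- The increment is split: moving x with directions y + tw as a convergent parameter gives d^{j+1}
  -- f, while moving y at fixed x is the derivative of a continuous multilinear map.
  have hpar := tendsto_slope_of_continuousAt (G := fun s p => iterDirDeriv f j (x + s • v) p)
    (G' := fun s p => iterDirDeriv f (j + 1) (x + s • v) (Fin.snoc (α := fun _ => V) p v))
    (p₀ := y) (p := fun t => y + t • w) ?_ ?_ ?_
  · unfold HasLineDerivAt
    rw [hasDerivAt_iff_tendsto_slope_zero]
    have := hpar.add hlin'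
    simp only [zero_smul, add_zero, zero_add] at this
    refine this.congr fun t => ?_
    simp only [zero_add, ← smul_add, Prod.smul_mk, Prod.mk_add_mk, zero_smul, add_zero]
    congr 1
    change iterDirDeriv f j (x + t • v) (y + t • w) - iterDirDeriv f j x (y + t • w)
      + (iterDirDeriv f j x (y + t • w) - iterDirDeriv f j x y) = _
    abel
  · filter_upwards [hcont.preimage_mem_nhds hmem] with z hz
    exact hasLineDerivAt_iff_hasDerivAt.1 (h.hasLineDerivAt hj hz _ _)
  · have hc : Continuous fun z : ℝ × (Fin j → V) =>
        snocCLM V j ((x + z.1 • v, z.2), (v, 0)) := by fun_prop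
    have hopen : IsOpen (U ×ˢ (univ : Set (Fin (j + 1) → V))) := hU.prod isOpen_univ
    refine ContinuousAt.comp (f := fun z : ℝ × (Fin j → V) =>
        snocCLM V j ((x + z.1 • v, z.2), (v, 0))) (g := fun p : V × (Fin (j + 1) → V) =>
        iterDirDeriv f (j + 1) p.1 p.2)
      ((h.2 (j + 1) hj).2.continuousAt (hopen.mem_nhds ⟨?_, mem_univ _⟩)) hc.continuousAt
    simpa [snocCLM] using hx
  · have : ContinuousAt (fun t : ℝ => y + t • w) 0 := by fun_prop
    have := this.tendsto
    simp only [zero_smul, add_zero] at this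
    exact this.mono_left nhdsWithin_le_nhds

/-- The joint derivative of d^j f is a sum of d^{j+1} f and copies of d^j f, each precomposed with
linear maps. Going from n + 1 to n with j raised by one keeps the total order n + j, hence the
induction on n for all j at once. -/
theorem bastianiC_iterDirDeriv (hU : IsOpen U) (n : ℕ) :
    ∀ {j : ℕ}, IsBastianiC ((n + j : ℕ) : ℕ∞) U f →
      BastianiC n (U ×ˢ univ) (fun p : V × (Fin j → V) => iterDirDeriv f j p.1 p.2) := by
  induction n with
  | zero =>
    intro j h
    exact (h.2 j (by simp)).2
  | succ n ih =>
    intro j h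
    have hj : ((j + 1 : ℕ) : ℕ∞) ≤ ((n + 1 + j : ℕ) : ℕ∞) := by
      exact_mod_cast (by omega : j + 1 ≤ n + 1 + j)
    refine ⟨(h.2 j (by exact_mod_cast (by omega : j ≤ n + 1 + j))).2, fun q =>
      iterDirDeriv f (j + 1) (snocCLM V j q).1 (snocCLM V j q).2
        + ∑ i : Fin j, iterDirDeriv f j (updateCLM V i q).1 (updateCLM V i q).2, ?_, ?_⟩
    · rintro ⟨x, y⟩ hx ⟨v, w⟩
      exact h.hasLineDerivAt_iterDirDeriv hU hj hx.1 y v w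
    · have hO : IsOpen ((U ×ˢ (univ : Set (Fin j → V))) ×ˢ (univ : Set (V × (Fin j → V)))) :=
        (hU.prod isOpen_univ).prod isOpen_univ
      have h1 := BastianiC.comp_clm (U := (U ×ˢ (univ : Set (Fin j → V))) ×ˢ univ)
        (ih (j := j + 1) (by rwa [add_comm j 1, ← add_assoc])) (snocCLM V j)
        fun p hp => ⟨hp.1.1, mem_univ _⟩
      refine BastianiC.contDiff_comp hO (contDiff_fst.add contDiff_snd)
        (h1.prodMk (BastianiC.sum hO (Finset.univ : Finset (Fin j)) fun i _ => ?_))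
      exact BastianiC.comp_clm (ih (j := j) (h.of_le
        (by exact_mod_cast (by omega : n + j ≤ n + 1 + j)))) (updateCLM V i)
        fun p hp => ⟨hp.1.1, mem_univ _⟩

theorem bastianiC (hU : IsOpen U) (h : IsBastianiC k U f) {n : ℕ} (hn : (n : ℕ∞) ≤ k) :
    BastianiC n U f := by
  have := bastianiC_iterDirDeriv hU n (j := 0) (h.of_le (m := ((n + 0 : ℕ) : ℕ∞)) hn)
  exact this.comp_clm (ContinuousLinearMap.inl ℝ V (Fin 0 → V)) fun x hx => ⟨hx, mem_univ _⟩

end IsBastianiC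

end Conversion

/-! ### Superposition operators on spaces of continuous functions -/

section Superposition

variable {T : Type*} [TopologicalSpace T] {V W : Type*}

open Classical in
/-- The superposition operator `γ ↦ g ∘ γ` (with value `0` if `g ∘ γ` is not continuous). -/
noncomputable def superpos (T : Type*) [TopologicalSpace T] {V W : Type*} [TopologicalSpace V]
    [TopologicalSpace W] [Zero W] (g : V → W) (γ : C(T, V)) : C(T, W) :=
  if h : Continuous (fun t => g (γ t)) then ⟨fun t => g (γ t), h⟩ else 0

theorem superpos_apply [TopologicalSpace V] [TopologicalSpace W] [Zero W] {g : V → W} {U : Set V}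
    (hg : ContinuousOn g U) {γ : C(T, V)} (hγ : ∀ t, γ t ∈ U) (t : T) :
    superpos T g γ t = g (γ t) := by
  have : Continuous fun t => g (γ t) := hg.comp_continuous γ.continuous hγ
  simp [superpos, this]

variable [CompactSpace T] [NormedAddCommGroup V] [NormedAddCommGroup W]

/-- The set of continuous functions with values in `U`. -/
def valuedIn (T : Type*) [TopologicalSpace T] {V : Type*} [TopologicalSpace V] (U : Set V) :
    Set C(T, V) := {γ | ∀ t, γ t ∈ U}

theorem isOpen_valuedIn {U : Set V} (hU : IsOpen U) : IsOpen (valuedIn T U) := by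
  have := ContinuousMap.isOpen_setOfPred_mapsTo (X := T) (Y := V) isCompact_univ hU
  simpa [valuedIn, MapsTo] using this

theorem continuousOn_superpos {U : Set V} (hU : IsOpen U) {g : V → W} (hg : ContinuousOn g U) :
    ContinuousOn (superpos T g) (valuedIn T U) := by
  intro γ hγ
  refine ContinuousAt.continuousWithinAt ?_
  rw [Metric.continuousAt_iff']
  intro ε hε
  have hK : IsCompact (range γ) := isCompact_range γ.continuous
  -- Compactness of the range of γ gives one δ valid at all points γ(t), although g is merely
  -- continuous on U.
  have h1 := hK.uniformContinuousAt_of_continuousAt (f := g) (r := {p | dist p.1 p.2 < ε / 2})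
    (by
      rintro _ ⟨t, rfl⟩
      exact hg.continuousAt (hU.mem_nhds (hγ t))) (Metric.dist_mem_uniformity (half_pos hε))
  obtain ⟨δ, hδ, hδ'⟩ := Metric.mem_uniformity_dist.1 h1
  filter_upwards [(isOpen_valuedIn hU).mem_nhds hγ, Metric.ball_mem_nhds γ hδ] with η hη hd
  refine lt_of_le_of_lt ((ContinuousMap.dist_le (half_pos hε).le).2 fun t => ?_) (half_lt_self hε)
  rw [superpos_apply hg hη, superpos_apply hg hγ, dist_comm]
  refine le_of_lt (hδ' ?_ ⟨t, rfl⟩)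
  rw [dist_comm]
  exact lt_of_le_of_lt (ContinuousMap.dist_apply_le_dist t) hd

variable [NormedSpace ℝ V] [NormedSpace ℝ W]

/-- A path of continuous functions which is pointwise differentiable, with derivatives forming
a continuous path of continuous functions, is differentiable. -/
theorem hasDerivAt_continuousMap {c c' : ℝ → C(T, W)}
    (hc : ∀ᶠ s in 𝓝 (0 : ℝ), ∀ t, HasDerivAt (fun r => c r t) (c' s t) s)
    (hc' : ContinuousAt c' 0) : HasDerivAt c (c' 0) 0 := by
  rw [hasDerivAt_iff_isLittleO, Asymptotics.isLittleO_iff]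
  intro ε hε
  have h2 : ∀ᶠ s in 𝓝 (0 : ℝ), dist (c' s) (c' 0) < ε :=
    hc'.eventually (Metric.ball_mem_nhds _ hε)
  obtain ⟨δ, hδ, hδA⟩ := Metric.eventually_nhds_iff_ball.1 (hc.and h2)
  filter_upwards [Metric.ball_mem_nhds (0 : ℝ) hδ] with s hs
  refine (ContinuousMap.norm_le _ (by positivity)).2 fun t => ?_
  have key := (convex_ball (0 : ℝ) δ).norm_image_sub_le_of_norm_hasDerivWithin_le
    (f := fun s => c s t - s • c' 0 t) (f' := fun s => c' s t - c' 0 t) (C := ε)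
    (fun r hr => by
      have := ((hδA r hr).1 t).fun_sub ((hasDerivAt_id' r).smul_const (c' 0 t))
      rw [one_smul] at this
      exact this.hasDerivWithinAt)
    (fun r hr => by
      rw [← dist_eq_norm]
      exact (ContinuousMap.dist_apply_le_dist t).trans (hδA r hr).2.le)
    (Metric.mem_ball_self hδ) hs
  have e : (c s - c 0 - (s - 0) • c' 0) t
      = (c s t - s • c' 0 t) - (c 0 t - (0 : ℝ) • c' 0 t) := by
    simp only [ContinuousMap.sub_apply, ContinuousMap.smul_apply, sub_zero, zero_smul]
    abel
  rw [e]
  exact key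

/-- The isomorphism `C(T, V) × C(T, V) → C(T, V × V)`. -/
noncomputable def prodMkCLM (T : Type*) [TopologicalSpace T] [CompactSpace T] (V : Type*)
    [NormedAddCommGroup V] [NormedSpace ℝ V] : C(T, V) × C(T, V) →L[ℝ] C(T, V × V) :=
  LinearMap.mkContinuous
    { toFun := fun p => p.1.prodMk p.2
      map_add' := fun p q => by ext <;> simp
      map_smul' := fun c p => by ext <;> simp } 1 fun p => by
    refine (ContinuousMap.norm_le _ (by positivity)).2 fun t => ?_
    rw [one_mul]
    exact max_le_max (p.1.norm_coe_le_norm t) (p.2.norm_coe_le_norm t)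

/-- The derivative at (γ,η) is t ↦ dg(γ(t),η(t)), so it is the superposition operator of dg after
identifying C(T,V)² with C(T,V × V), and induction applies to dg. Pointwise differentiability
becomes differentiability in the supremum norm by `hasDerivAt_continuousMap`. -/
theorem BastianiC.superpos {k : ℕ} {V : Type*} [NormedAddCommGroup V] [NormedSpace ℝ V] {U : Set V}
    (hU : IsOpen U) {g : V → W} (hg : BastianiC k U g) :
    BastianiC k (valuedIn T U) (superpos T g) := by
  induction k generalizing V with
  | zero => exact continuousOn_superpos hU hg
  | succ k ih =>
    obtain ⟨g0, dg, g1, g2⟩ := hg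
    have hO : IsOpen (U ×ˢ (univ : Set V)) := hU.prod isOpen_univ
    have hmaps : MapsTo (prodMkCLM T V) (valuedIn T U ×ˢ univ)
        (valuedIn T (U ×ˢ (univ : Set V))) := fun p hp t => ⟨hp.1 t, mem_univ _⟩
    refine ⟨continuousOn_superpos hU g0, fun p => BVODE.superpos T dg (prodMkCLM T V p),
      fun γ hγ η => ?_, ?_⟩
    · have hc : Continuous fun s : ℝ => γ + s • η := by fun_prop
      have hγ0 : γ + (0 : ℝ) • η ∈ valuedIn T U := by simpa using hγ
      have := hasDerivAt_continuousMap (c := fun s : ℝ => BVODE.superpos T g (γ + s • η))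
        (c' := fun s : ℝ => BVODE.superpos T dg (prodMkCLM T V (γ + s • η, η))) ?_ ?_
      · unfold HasLineDerivAt
        simpa using this
      · have hev : ∀ᶠ s in 𝓝 (0 : ℝ), γ + s • η ∈ valuedIn T U :=
          hc.continuousAt.eventually ((isOpen_valuedIn hU).mem_nhds hγ0)
        filter_upwards [hev.eventually_nhds] with s hs t
        have hs0 := hs.self_of_nhds
        rw [superpos_apply g2.continuousOn (hmaps ⟨hs0, mem_univ _⟩)]
        have h3 := hasLineDerivAt_iff_hasDerivAt.1 (g1 _ (hs0 t) (η t))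
        refine h3.congr_of_eventuallyEq ?_
        filter_upwards [hs] with r hr
        rw [superpos_apply g0 hr]
        rfl
      · have hc2 : ContinuousAt (fun s : ℝ => prodMkCLM T V (γ + s • η, η)) 0 := by fun_prop
        refine ContinuousAt.comp (f := fun s : ℝ => prodMkCLM T V (γ + s • η, η))
          (g := BVODE.superpos T dg) ?_ hc2
        exact (continuousOn_superpos hO g2.continuousOn).continuousAt
          ((isOpen_valuedIn hO).mem_nhds (hmaps ⟨hγ0, mem_univ _⟩))
    · exact (ih hO g2).comp_clm (prodMkCLM T V) hmaps

end Superposition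

/-! ### Parameter dependence of fixed points -/

section FixedPoint

/-- Fixed points of uniform contractions depend continuously on parameters. -/
theorem continuousOn_fixedPoint {Z : Type*} [NormedAddCommGroup Z] [NormedSpace ℝ Z] {P : Type*} [NormedAddCommGroup P] [NormedSpace ℝ P] {Q : Set P} (hQ : IsOpen Q)
    {U : Set Z} (hU : IsOpen U) {H : P × Z → Z} (hH : ContinuousOn H (Q ×ˢ U)) {θ : P → ℝ}
    (hθ : Continuous θ) (hθ1 : ∀ p ∈ Q, θ p < 1)
    (hc : ∀ p ∈ Q, ∀ z ∈ U, ∀ z' ∈ U, ‖H (p, z) - H (p, z')‖ ≤ θ p * ‖z - z'‖)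
    {g : P → Z} (hgU : ∀ p ∈ Q, g p ∈ U) (hg : ∀ p ∈ Q, H (p, g p) = g p) :
    ContinuousOn g Q := by
  intro p hp
  refine ContinuousAt.continuousWithinAt ?_
  have hHp : ContinuousAt (fun q => H (q, g p)) p :=
    ContinuousAt.comp (f := fun q => (q, g p)) (hH.continuousAt
      ((hQ.prod hU).mem_nhds ⟨hp, hgU p hp⟩)) (by fun_prop)
  have hlim : Tendsto (fun q => (1 - θ q)⁻¹ * ‖H (q, g p) - H (p, g p)‖) (𝓝 p) (𝓝 0) := by
    have h1 : Tendsto (fun q => (1 - θ q)⁻¹) (𝓝 p) (𝓝 (1 - θ p)⁻¹) :=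
      (hθ.continuousAt.tendsto.const_sub 1).inv₀ (by linarith [hθ1 p hp])
    have h2 := h1.mul (hHp.tendsto.sub_const (H (p, g p))).norm
    simpa using h2
  rw [ContinuousAt, tendsto_iff_norm_sub_tendsto_zero]
  refine squeeze_zero' (Eventually.of_forall fun q => norm_nonneg _) ?_ hlim
  filter_upwards [hQ.mem_nhds hp] with q hq
  have hpos : 0 < 1 - θ q := by linarith [hθ1 q hq]
  rw [le_inv_mul_iff₀ hpos]
  -- The first difference is at most θ(q)‖g q − g p‖ and is absorbed on the left, leaving the factor
  -- 1 − θ(q).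
  have e : g q - g p = (H (q, g q) - H (q, g p)) + (H (q, g p) - H (p, g p)) := by
    rw [hg q hq, hg p hp]; abel
  have h3 := hc q hq _ (hgU q hq) _ (hgU p hp)
  have h4 : ‖g q - g p‖ ≤ ‖H (q, g q) - H (q, g p)‖ + ‖H (q, g p) - H (p, g p)‖ := by
    conv_lhs => rw [e]
    exact norm_add_le _ _
  linarith

/-- Fixed points of uniform contractions depend on parameters as smoothly as the contractions. -/
theorem BastianiC.fixedPoint {Z : Type*} [NormedAddCommGroup Z] [NormedSpace ℝ Z] [CompleteSpace Z]
    {k : ℕ} {P : Type u} [NormedAddCommGroup P] [NormedSpace ℝ P] {Q : Set P} (hQ : IsOpen Q)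
    {U : Set Z} (hU : IsOpen U) {H : P × Z → Z} (hH : BastianiC k (Q ×ˢ U) H) {θ : P → ℝ}
    (hθ : Continuous θ) (hθ0 : ∀ p, 0 ≤ θ p) (hθ1 : ∀ p ∈ Q, θ p < 1)
    (hc : ∀ p ∈ Q, ∀ z ∈ U, ∀ z' ∈ U, ‖H (p, z) - H (p, z')‖ ≤ θ p * ‖z - z'‖)
    {g : P → Z} (hgU : ∀ p ∈ Q, g p ∈ U) (hg : ∀ p ∈ Q, H (p, g p) = g p) :
    BastianiC k Q g := by
  induction k generalizing P U with
  | zero => exact continuousOn_fixedPoint hQ hU hH hθ hθ1 hc hgU hg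
  | succ k ih =>
    have hgk : BastianiC k Q g := ih hQ hU hH.of_succ hθ hθ0 hθ1 hc hgU hg
    obtain ⟨-, dH, h1, h2⟩ := hH
    -- The contraction estimate passes to the limit of difference quotients. As g(p) + tz lies in U
    -- for small t, the linearised map contracts on all of Z, so the induction hypothesis is later
    -- used with U = `univ`.
    have hdc : ∀ p ∈ Q, ∀ v : P, ∀ z z' : Z,
        ‖dH ((p, g p), (v, z)) - dH ((p, g p), (v, z'))‖ ≤ θ p * ‖z - z'‖ := by
      intro p hp v z z'
      have a1 := hasDerivAt_iff_tendsto_slope_zero.1 (h1 (p, g p) ⟨hp, hgU p hp⟩ (v, z))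
      have a2 := hasDerivAt_iff_tendsto_slope_zero.1 (h1 (p, g p) ⟨hp, hgU p hp⟩ (v, z'))
      have b : Tendsto (fun t : ℝ => θ (p + t • v) * ‖z - z'‖) (𝓝[≠] 0) (𝓝 (θ p * ‖z - z'‖)) := by
        have : Continuous fun t : ℝ => θ (p + t • v) * ‖z - z'‖ := by fun_prop
        have := this.tendsto 0
        simp only [zero_smul, add_zero] at this
        exact this.mono_left nhdsWithin_le_nhds
      refine le_of_tendsto_of_tendsto (a1.sub a2).norm b ?_
      have c1 : ∀ᶠ t : ℝ in 𝓝 0, p + t • v ∈ Q :=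
        (show Continuous fun t : ℝ => p + t • v by fun_prop).continuousAt.eventually
          (hQ.mem_nhds (by simpa using hp))
      have c2 : ∀ w : Z, ∀ᶠ t : ℝ in 𝓝 0, g p + t • w ∈ U := fun w =>
        (show Continuous fun t : ℝ => g p + t • w by fun_prop).continuousAt.eventually
          (hU.mem_nhds (by simpa using hgU p hp))
      filter_upwards [nhdsWithin_le_nhds c1, nhdsWithin_le_nhds (c2 z), nhdsWithin_le_nhds (c2 z'),
        self_mem_nhdsWithin] with t t1 t2 t3 t4
      have t4 : t ≠ 0 := t4
      have t5 := hc _ t1 _ t2 _ t3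
      simp only [zero_add, zero_smul, add_zero, ← smul_sub, sub_sub_sub_cancel_right,
        Prod.smul_mk, Prod.mk_add_mk]
      rw [norm_smul, norm_inv, inv_mul_le_iff₀ (norm_pos_iff.2 t4)]
      rw [add_sub_add_left_eq_sub, ← smul_sub, norm_smul] at t5
      linarith
    -- Formally differentiating H(p,g(p)) = g(p) shows that the derivative in direction v must
    -- satisfy this fixed point equation; Banach's theorem supplies the candidate. The value 0 off Q
    -- plays no role.
    have hex : ∀ q : P × P, ∃ z : Z, q.1 ∈ Q → dH ((q.1, g q.1), (q.2, z)) = z := by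
      rintro ⟨p, v⟩
      by_cases hp : p ∈ Q
      · have hcw : ContractingWith ⟨θ p, hθ0 p⟩ (fun z => dH ((p, g p), (v, z))) := by
          refine ⟨by exact_mod_cast hθ1 p hp, LipschitzWith.of_dist_le_mul fun z z' => ?_⟩
          rw [dist_eq_norm, dist_eq_norm]
          exact hdc p hp v z z'
        exact ⟨hcw.fixedPoint, fun _ => hcw.fixedPoint_isFixedPt⟩
      · exact ⟨0, fun h => absurd h hp⟩
    choose dg hdg using hex
    have hQ' : IsOpen (Q ×ˢ (univ : Set P)) := hQ.prod isOpen_univ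
    -- The linearised contraction involves g itself, which is already known to be C^k by induction;
    -- so its fixed point is C^k too, making g of class C^{k+1}.
    have hBH : BastianiC k ((Q ×ˢ (univ : Set P)) ×ˢ (univ : Set Z))
        (fun q : (P × P) × Z => dH ((q.1.1, g q.1.1), (q.1.2, q.2))) := by
      have hO := hQ'.prod (isOpen_univ (X := Z))
      refine BastianiC.comp hO ((hQ.prod hU).prod isOpen_univ) h2
        (f := fun q : (P × P) × Z => ((q.1.1, g q.1.1), (q.1.2, q.2))) ?_
        fun q hq => ⟨⟨hq.1.1, hgU _ hq.1.1⟩, mem_univ _⟩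
      refine BastianiC.prodMk (BastianiC.prodMk (BastianiC.of_contDiff (by fun_prop) _) ?_)
        (BastianiC.of_contDiff (by fun_prop) _)
      exact hgk.comp_clm ((ContinuousLinearMap.fst ℝ P P).comp (ContinuousLinearMap.fst ℝ (P × P) Z))
        fun q hq => hq.1.1
    refine ⟨hgk.continuousOn, dg, fun p hp v => ?_, ?_⟩
    · have hz := hdg (p, v) hp
      simp only at hz
      set z := dg (p, v) with hzdef
      unfold HasLineDerivAt
      rw [hasDerivAt_iff_tendsto_slope_zero]
      have a1 := hasDerivAt_iff_tendsto_slope_zero.1 (h1 (p, g p) ⟨hp, hgU p hp⟩ (v, z))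
      rw [hz] at a1
      simp only [zero_add, zero_smul, add_zero, Prod.smul_mk, Prod.mk_add_mk] at a1 ⊢
      -- Comparing g(p + tv) with its first-order prediction g(p) + tz through the contraction
      -- bounds the error of the quotient by this expression, which tends to 0 since dH(…, (v,z)) =
      -- z.
      have hlim : Tendsto (fun t : ℝ => (1 - θ (p + t • v))⁻¹ *
          ‖t⁻¹ • (H (p + t • v, g p + t • z) - H (p, g p)) - z‖) (𝓝[≠] 0) (𝓝 0) := by
        have b : Tendsto (fun t : ℝ => (1 - θ (p + t • v))⁻¹) (𝓝[≠] 0) (𝓝 (1 - θ p)⁻¹) := by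
          have : Continuous fun t : ℝ => θ (p + t • v) := by fun_prop
          have := this.tendsto 0
          simp only [zero_smul, add_zero] at this
          exact ((this.mono_left nhdsWithin_le_nhds).const_sub 1).inv₀ (by linarith [hθ1 p hp])
        simpa using b.mul (a1.sub_const z).norm
      rw [tendsto_iff_norm_sub_tendsto_zero]
      refine squeeze_zero' (Eventually.of_forall fun q => norm_nonneg _) ?_ hlim
      have c1 : ∀ᶠ t : ℝ in 𝓝 0, p + t • v ∈ Q :=
        (show Continuous fun t : ℝ => p + t • v by fun_prop).continuousAt.eventually
          (hQ.mem_nhds (by simpa using hp))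
      have c2 : ∀ᶠ t : ℝ in 𝓝 0, g p + t • z ∈ U :=
        (show Continuous fun t : ℝ => g p + t • z by fun_prop).continuousAt.eventually
          (hU.mem_nhds (by simpa using hgU p hp))
      filter_upwards [nhdsWithin_le_nhds c1, nhdsWithin_le_nhds c2, self_mem_nhdsWithin]
        with t t1 t2 t4
      have t4 : t ≠ 0 := t4
      have hpos : 0 < 1 - θ (p + t • v) := by linarith [hθ1 _ t1]
      rw [le_inv_mul_iff₀ hpos]
      have t5 := hc _ t1 _ (hgU _ t1) _ t2
      rw [hg _ t1] at t5
      have e1 : g (p + t • v) - (g p + t • z) = t • (t⁻¹ • (g (p + t • v) - g p) - z) := by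
        rw [smul_sub, smul_smul, mul_inv_cancel₀ t4, one_smul]; abel
      have e2 : g (p + t • v) - H (p + t • v, g p + t • z)
          = t • ((t⁻¹ • (g (p + t • v) - g p) - z)
            - (t⁻¹ • (H (p + t • v, g p + t • z) - H (p, g p)) - z)) := by
        rw [sub_sub_sub_cancel_right, smul_sub, smul_smul, smul_smul, mul_inv_cancel₀ t4, one_smul,
          one_smul, hg p hp]
        abel
      rw [e1, e2, norm_smul, norm_smul, mul_left_comm,
        mul_le_mul_iff_right₀ (norm_pos_iff.2 t4)] at t5
      have t6 := norm_sub_norm_le (t⁻¹ • (g (p + t • v) - g p) - z)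
        (t⁻¹ • (H (p + t • v, g p + t • z) - H (p, g p)) - z)
      linarith
    · exact ih hQ' isOpen_univ hBH (θ := fun q => θ q.1) (by fun_prop) (fun q => hθ0 _)
        (fun q hq => hθ1 _ hq.1) (fun q hq z _ z' _ => hdc q.1 hq.1 q.2 z z')
        (fun q _ => mem_univ _) (fun q hq => hdg q hq.1)

end FixedPoint

/-! ### Operator-valued densities and small neighbourhoods of null points -/

section Density

variable {X : Type*} [MeasurableSpace X] {E F : Type*} [NormedAddCommGroup E] [NormedSpace ℝ E]
  [NormedAddCommGroup F] [NormedSpace ℝ F]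

theorem integrable_apply_of_bounded {ν : Measure X} {ρ : X → E} (hρ : Integrable ρ ν)
    {A : X → E →L[ℝ] F} (hA : AEStronglyMeasurable A ν) {C : ℝ} (hC : ∀ x, ‖A x‖ ≤ C) :
    Integrable (fun x => A x (ρ x)) ν := by
  refine (hρ.norm.const_mul C).mono'
    (isBoundedBilinearMap_apply.continuous.comp_aestronglyMeasurable (hA.prodMk hρ.1))
    (Eventually.of_forall fun x => ?_)
  exact (A x).le_of_opNorm_le (hC x) (ρ x)

variable [CompleteSpace F]

theorem integral_simpleFunc_withDensityᵥ [CompleteSpace E] {ν : Measure X} {ρ : X → E}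
    (hρ : Integrable ρ ν) [IsFiniteMeasure (ν.withDensityᵥ ρ).variation] {s : Set X}
    (hs : MeasurableSet s) (A : SimpleFunc X (E →L[ℝ] F)) :
    ((ν.withDensityᵥ ρ).restrict s).integral A (ContinuousLinearMap.id ℝ (E →L[ℝ] F))
      = ∫ x in s, A x (ρ x) ∂ν := by
  induction A using SimpleFunc.induction with
  | const c ht =>
    rename_i t
    have e0 : ⇑(SimpleFunc.piecewise t ht (SimpleFunc.const X c) (SimpleFunc.const X 0))
        = t.indicator fun _ => c := by
      funext x
      by_cases hx : x ∈ t <;> simp [hx]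
    rw [e0]
    rw [VectorMeasure.integral_indicator_const c ht, VectorMeasure.restrict_apply _ hs ht,
      withDensityᵥ_apply hρ (ht.inter hs)]
    have e : (fun x => (t.indicator (fun _ => c) x) (ρ x)) = t.indicator fun x => c (ρ x) := by
      funext x
      by_cases hx : x ∈ t <;> simp [hx]
    rw [e, integral_indicator ht, Measure.restrict_restrict ht]
    exact (c.integral_comp_comm hρ.integrableOn).symm
  | add hd h1 h2 =>
    rename_i f g
    have hint : ∀ h : SimpleFunc X (E →L[ℝ] F), Integrable (fun x => h x (ρ x)) (ν.restrict s) := by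
      intro h
      obtain ⟨C, hC⟩ := h.exists_forall_norm_le
      exact integrable_apply_of_bounded hρ.restrict h.aestronglyMeasurable hC
    rw [SimpleFunc.coe_add, VectorMeasure.integral_add (SimpleFunc.integrable_of_isFiniteMeasure f)
      (SimpleFunc.integrable_of_isFiniteMeasure g), h1, h2, ← integral_add (hint f) (hint g)]
    simp

/-- The measure `A d(ρ dν)` has density `x ↦ A x (ρ x)` with respect to `ν`. -/
theorem withDensity_withDensityᵥ [CompleteSpace E] {ν : Measure X} {ρ : X → E}
    (hρ : Integrable ρ ν) [IsFiniteMeasure (ν.withDensityᵥ ρ).variation] {A : X → E →L[ℝ] F}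
    (hA : StronglyMeasurable A) {C : ℝ} (hC : ∀ x, ‖A x‖ ≤ C) :
    (ν.withDensityᵥ ρ).withDensity A (ContinuousLinearMap.id ℝ (E →L[ℝ] F))
      = ν.withDensityᵥ (fun x => A x (ρ x)) := by
  have hint : (ν.withDensityᵥ ρ).Integrable A :=
    (integrable_const C).mono' hA.aestronglyMeasurable (Eventually.of_forall hC)
  ext s hs
  rw [VectorMeasure.withDensity_apply hint,
    withDensityᵥ_apply (integrable_apply_of_bounded hρ hA.aestronglyMeasurable hC) hs]
  -- A point is needed to conclude 0 ≤ C from the bound on A.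
  rcases isEmpty_or_nonempty X with hX | ⟨⟨x₀⟩⟩
  · simp [Set.eq_empty_of_isEmpty s]
  have hC0 : 0 ≤ C := (norm_nonneg _).trans (hC x₀)
  -- Approximate A by simple functions bounded by C, for which both integrals agree. Dominated
  -- convergence applies on both sides, with majorants C and C‖ρ‖.
  have h1 := VectorMeasure.tendsto_integral_of_dominated_convergence
    (μ := (ν.withDensityᵥ ρ).restrict s) (B := ContinuousLinearMap.id ℝ (E →L[ℝ] F))
    (f := A) (fun _ => C)
    (fun n => (hA.approxBounded C n).aestronglyMeasurable) (integrable_const C)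
    (fun n => Eventually.of_forall fun x => hA.norm_approxBounded_le hC0 n x)
    (Eventually.of_forall fun x => hA.tendsto_approxBounded_of_norm_le (hC x))
  have h2 := tendsto_integral_of_dominated_convergence
    (μ := ν.restrict s) (F := fun n x => hA.approxBounded C n x (ρ x))
    (f := fun x => A x (ρ x)) (fun x => C * ‖ρ x‖)
    (fun n => (integrable_apply_of_bounded hρ.restrict
      (hA.approxBounded C n).aestronglyMeasurable (hA.norm_approxBounded_le hC0 n)).1)
    (hρ.restrict.norm.const_mul C)
    (fun n => Eventually.of_forall fun x =>
      ContinuousLinearMap.le_of_opNorm_le _ (hA.norm_approxBounded_le hC0 n x) _)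
    (Eventually.of_forall fun x =>
      ((ContinuousLinearMap.apply ℝ F (ρ x)).continuous.tendsto (A x)).comp
        (hA.tendsto_approxBounded_of_norm_le (hC x)))
  refine tendsto_nhds_unique h1 (h2.congr fun n => ?_)
  exact (integral_simpleFunc_withDensityᵥ hρ hs _).symm

/-- Small neighbourhoods of a null point have small measure. -/
theorem exists_measureReal_closedBall_lt {Y : Type*} [PseudoMetricSpace Y] [T1Space Y]
    [MeasurableSpace Y] [OpensMeasurableSpace Y] (m : Measure Y) [IsFiniteMeasure m] {y : Y}
    (hy : m {y} = 0) {ε : ℝ} (hε : 0 < ε) : ∃ δ > 0, m.real (Metric.closedBall y δ) < ε := by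
  have h := tendsto_measure_cthickening_of_isClosed (μ := m) (s := {y})
    ⟨1, one_pos, measure_ne_top _ _⟩ isClosed_singleton
  rw [hy] at h
  have h2 := h.eventually (gt_mem_nhds (ENNReal.ofReal_pos.2 hε))
  obtain ⟨δ, hδ, hb⟩ := Metric.eventually_nhds_iff_ball.1 h2
  refine ⟨δ / 2, half_pos hδ, ?_⟩
  have := hb (δ / 2) (by rw [Metric.mem_ball, Real.dist_eq, sub_zero, abs_of_pos (half_pos hδ)]
                         exact half_lt_self hδ)
  rw [Metric.cthickening_singleton _ (half_pos hδ).le] at this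
  exact (ENNReal.lt_ofReal_iff_toReal_lt (measure_ne_top _ _)).1 this

end Density

/-! ### Continuity of primitives of non-atomic measures -/

section Interval

variable {a b : ℝ} {E F : Type*} [NormedAddCommGroup E] [NormedSpace ℝ E]
  [NormedAddCommGroup F] [NormedSpace ℝ F]

namespace NAMeas

instance (μ : NAMeas a b E) : IsFiniteMeasure μ.toVM.variation := ⟨μ.variation_lt_top⟩

theorem apply_singleton (μ : NAMeas a b E) (x : Icc a b) : μ.toVM {x} = 0 :=
  (isNonatomic_iff _).1 μ.2.2.2 x

/-- This transfers non-atomicity to the variation, the form in which it enters continuity of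
primitives, local uniqueness, and non-atomicity of A dμ. -/
theorem variation_singleton (μ : NAMeas a b E) (x : Icc a b) : μ.toVM.variation {x} = 0 := by
  rw [VectorMeasure.variation_apply_eq_zero (measurableSet_singleton x)]
  intro t ht _
  rcases subset_singleton_iff_eq.1 ht with rfl | rfl
  · exact μ.toVM.empty
  · exact μ.apply_singleton x

theorem variation_real_le (μ : NAMeas a b E) (s : Set (Icc a b)) :
    μ.toVM.variation.real s ≤ ‖μ‖ := measureReal_mono (subset_univ s)

theorem apply_Ioc (μ : NAMeas a b E) {x y : Icc a b} (h : x ≤ y) :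
    μ.toVM (Ioc x y) = μ.toVM (Iic y) - μ.toVM (Iic x) := by
  rw [← VectorMeasure.of_sdiff measurableSet_Iic measurableSet_Iic (Iic_subset_Iic.2 h)]
  congr 1
  ext z
  simp [and_comm]

theorem norm_Iic_sub_le (μ : NAMeas a b E) (x y : Icc a b) :
    ‖μ.toVM (Iic x) - μ.toVM (Iic y)‖ ≤ μ.toVM.variation.real (uIoc x y) := by
  wlog h : x ≤ y generalizing x y
  · rw [norm_sub_rev, uIoc_comm]
    exact this y x (le_of_not_ge h)
  rw [uIoc_of_le h, norm_sub_rev, ← apply_Ioc μ h]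
  exact VectorMeasure.norm_measure_le_variation (measure_ne_top _ _)

theorem continuous_Iic (μ : NAMeas a b E) : Continuous fun x => μ.toVM (Iic x) := by
  rw [Metric.continuous_iff]
  intro x ε hε
  obtain ⟨δ, hδ, h⟩ := exists_measureReal_closedBall_lt _ (μ.variation_singleton x) hε
  refine ⟨δ, hδ, fun y hy => ?_⟩
  rw [dist_eq_norm]
  refine ((μ.norm_Iic_sub_le y x).trans (measureReal_mono fun z hz => ?_)).trans_lt h
  rw [Subtype.dist_eq, Real.dist_eq, abs_lt] at hy
  rw [Metric.mem_closedBall, Subtype.dist_eq, Real.dist_eq, abs_le]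
  simp only [mem_uIoc, ← Subtype.coe_lt_coe, ← Subtype.coe_le_coe] at hz
  constructor <;> rcases hz with hz | hz <;> linarith [hz.1, hz.2, hy.1, hy.2]

end NAMeas

end Interval

/-! ### The bilinear pairing of densities and measures, and primitives -/

section Operators

variable {a b : ℝ} {E F : Type*} [NormedAddCommGroup E] [NormedSpace ℝ E]
  [NormedAddCommGroup F] [NormedSpace ℝ F]

theorem integrable_of_continuous {E F : Type*} [NormedAddCommGroup E]
    [NormedAddCommGroup F] {μ : VectorMeasure (Icc a b) E} [IsFiniteMeasure μ.variation]
    (A : C(Icc a b, F)) : μ.Integrable A :=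
  (integrable_const ‖A‖).mono' A.continuous.aestronglyMeasurable
    (Eventually.of_forall A.norm_coe_le_norm)

/-- The variation lies below any positive measure dominating the norm on each set, so the estimate
of the integral over a single set suffices. -/
theorem variation_withDensity_id_univ_le {X : Type*} [MeasurableSpace X] (μ : VectorMeasure X E)
    {A : X → E →L[ℝ] F} {C : ℝ} (hC : ∀ x, ‖A x‖ ≤ C) :
    (μ.withDensity A (ContinuousLinearMap.id ℝ (E →L[ℝ] F))).variation univ
      ≤ ENNReal.ofReal C * μ.variation univ := by
  suffices h : (μ.withDensity A (ContinuousLinearMap.id ℝ (E →L[ℝ] F))).variation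
      ≤ ENNReal.ofReal C • μ.variation from h univ
  refine VectorMeasure.variation_le_of_forall_enorm_le fun s _ => ?_
  by_cases hA : μ.Integrable A
  · rw [VectorMeasure.withDensity_apply hA, Measure.smul_apply, smul_eq_mul]
    refine (VectorMeasure.enorm_setIntegral_le_of_enorm_le_const (C := ENNReal.ofReal C)
      fun x _ => ?_).trans ?_
    · rw [← ofReal_norm]
      exact ENNReal.ofReal_le_ofReal (hC x)
    · have h1 : ‖ContinuousLinearMap.id ℝ (E →L[ℝ] F)‖ₑ ≤ 1 := by
        rw [← ofReal_norm, ← ENNReal.ofReal_one]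
        exact ENNReal.ofReal_le_ofReal ContinuousLinearMap.norm_id_le
      calc _ ≤ ENNReal.ofReal C * 1 * μ.variation s := by gcongr
        _ = _ := by rw [mul_one]
  -- For a non-integrable density the measure is 0 by convention.
  · simp [VectorMeasure.withDensity, hA]

namespace NAMeas

variable [CompleteSpace E] [CompleteSpace F]

/-- The measure with continuous operator-valued density `A` with respect to `μ`. -/
noncomputable def withDensity (A : C(Icc a b, E →L[ℝ] F)) (μ : NAMeas a b E) : NAMeas a b F :=
  ⟨μ.toVM.withDensity A (ContinuousLinearMap.id ℝ (E →L[ℝ] F)), by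
    refine ⟨?_, ?_, ?_⟩
    · exact (variation_withDensity_id_univ_le _ A.norm_coe_le_norm).trans_lt
        (ENNReal.mul_lt_top ENNReal.ofReal_lt_top μ.variation_lt_top)
    · obtain ⟨ν, ρ, hν, hρ, e⟩ := μ.2.2.1
      have e : μ.toVM = ν.withDensityᵥ ρ := e
      have : IsFiniteMeasure (ν.withDensityᵥ ρ).variation := by rw [← e]; infer_instance
      refine ⟨ν, fun x => A x (ρ x), hν,
        integrable_apply_of_bounded hρ A.continuous.aestronglyMeasurable A.norm_coe_le_norm, ?_⟩
      rw [e]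
      exact withDensity_withDensityᵥ hρ A.continuous.stronglyMeasurable A.norm_coe_le_norm
    · rw [isNonatomic_iff]
      intro x
      rw [VectorMeasure.withDensity_apply (integrable_of_continuous A)]
      exact VectorMeasure.setIntegral_of_variation_apply_eq_zero _ (μ.variation_singleton x)⟩

theorem toVM_withDensity (A : C(Icc a b, E →L[ℝ] F)) (μ : NAMeas a b E) :
    (withDensity A μ).toVM = μ.toVM.withDensity A (ContinuousLinearMap.id ℝ (E →L[ℝ] F)) := rfl

theorem withDensity_apply (A : C(Icc a b, E →L[ℝ] F)) (μ : NAMeas a b E) (s : Set (Icc a b)) :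
    (withDensity A μ).toVM s
      = (μ.toVM.restrict s).integral A (ContinuousLinearMap.id ℝ (E →L[ℝ] F)) :=
  VectorMeasure.withDensity_apply (integrable_of_continuous A)

theorem norm_withDensity_le (A : C(Icc a b, E →L[ℝ] F)) (μ : NAMeas a b E) :
    ‖withDensity A μ‖ ≤ ‖A‖ * ‖μ‖ := by
  rw [norm_def, norm_def, ← ENNReal.toReal_ofReal (norm_nonneg A), ← ENNReal.toReal_mul]
  exact ENNReal.toReal_mono
    (ENNReal.mul_lt_top ENNReal.ofReal_lt_top μ.variation_lt_top).ne
    (variation_withDensity_id_univ_le _ A.norm_coe_le_norm)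

theorem withDensity_add_left (A B : C(Icc a b, E →L[ℝ] F)) (μ : NAMeas a b E) :
    withDensity (A + B) μ = withDensity A μ + withDensity B μ := by
  refine toVM_injective (VectorMeasure.ext fun s _ => ?_)
  rw [toVM_add, add_apply, withDensity_apply, withDensity_apply, withDensity_apply,
    ← VectorMeasure.integral_add (integrable_of_continuous A) (integrable_of_continuous B)]
  rfl

theorem withDensity_smul_left (c : ℝ) (A : C(Icc a b, E →L[ℝ] F)) (μ : NAMeas a b E) :
    withDensity (c • A) μ = c • withDensity A μ := by
  refine toVM_injective (VectorMeasure.ext fun s _ => ?_)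
  rw [toVM_smul, smul_apply, withDensity_apply, withDensity_apply, ← VectorMeasure.integral_smul]
  rfl

theorem withDensity_add_right (A : C(Icc a b, E →L[ℝ] F)) (μ ν : NAMeas a b E) :
    withDensity A (μ + ν) = withDensity A μ + withDensity A ν := by
  refine toVM_injective (VectorMeasure.ext fun s _ => ?_)
  rw [toVM_add, add_apply, withDensity_apply, withDensity_apply, withDensity_apply,
    toVM_add, VectorMeasure.restrict_add, VectorMeasure.integral_add_vectorMeasure
      (integrable_of_continuous A) (integrable_of_continuous A)]

theorem withDensity_smul_right (c : ℝ) (A : C(Icc a b, E →L[ℝ] F)) (μ : NAMeas a b E) :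
    withDensity A (c • μ) = c • withDensity A μ := by
  refine toVM_injective (VectorMeasure.ext fun s _ => ?_)
  rw [toVM_smul, smul_apply, withDensity_apply, withDensity_apply, toVM_smul,
    VectorMeasure.restrict_smul, VectorMeasure.integral_smul_vectorMeasure]

/-- Bounded bilinear maps are smooth, so the Picard operator is as regular as the superposition
operator of f̃. -/
theorem isBoundedBilinearMap_withDensity : IsBoundedBilinearMap ℝ
    fun p : C(Icc a b, E →L[ℝ] F) × NAMeas a b E => withDensity p.1 p.2 where
  add_left := withDensity_add_left
  smul_left := withDensity_smul_left
  add_right := withDensity_add_right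
  smul_right := withDensity_smul_right
  bound := ⟨1, one_pos, fun A μ => by
    rw [one_mul]
    exact norm_withDensity_le A μ⟩

end NAMeas

/-- The operator taking a measure `ν` to its primitive vanishing at `t₀`. -/
noncomputable def primitive (F : Type*) [NormedAddCommGroup F] [NormedSpace ℝ F] (t₀ : Icc a b) :
    NAMeas a b F →L[ℝ] C(Icc a b, F) :=
  LinearMap.mkContinuous
    { toFun := fun ν => ⟨fun x => ν.toVM (Iic x) - ν.toVM (Iic t₀),
        ν.continuous_Iic.sub continuous_const⟩
      map_add' := fun ν ν' => by
        ext x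
        simp only [NAMeas.toVM_add, add_apply, ContinuousMap.coe_mk, ContinuousMap.add_apply]
        abel
      map_smul' := fun c ν => by
        ext x
        simp [smul_sub] } 1 fun ν => by
    refine (ContinuousMap.norm_le _ (by positivity)).2 fun x => ?_
    rw [one_mul]
    exact (ν.norm_Iic_sub_le x t₀).trans (ν.variation_real_le _)

@[simp] theorem primitive_apply (t₀ : Icc a b) (ν : NAMeas a b F) (x : Icc a b) :
    primitive F t₀ ν x = ν.toVM (Iic x) - ν.toVM (Iic t₀) := rfl

theorem norm_primitive_apply_le (t₀ : Icc a b) (ν : NAMeas a b F) : ‖primitive F t₀ ν‖ ≤ ‖ν‖ := by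
  refine (ContinuousMap.norm_le _ (by positivity)).2 fun x => ?_
  exact (ν.norm_Iic_sub_le x t₀).trans (ν.variation_real_le _)

variable [Fact (a < b)]

namespace BV

theorem apply_sub (γ : BV a b F) (x y : Icc a b) :
    γ x - γ y = γ.deriv.toVM (Iic x) - γ.deriv.toVM (Iic y) := by
  rw [γ.apply_eq x, γ.apply_eq y]
  abel

theorem continuous (γ : BV a b F) : Continuous γ := by
  have : (γ : Icc a b → F) = fun x => γ (left a b) + γ.deriv.toVM (Iic x) := funext γ.apply_eq
  rw [this]
  exact continuous_const.add γ.deriv.continuous_Iic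

/-- A function of bounded variation as a continuous map. -/
def toContinuousMap (γ : BV a b F) : C(Icc a b, F) := ⟨γ, γ.continuous⟩

@[simp] theorem toContinuousMap_apply (γ : BV a b F) (x : Icc a b) :
    γ.toContinuousMap x = γ x := rfl

/-- This turns the differential equation with a prescribed value at t₀ into a fixed point equation
in C([a,b],F). -/
theorem toContinuousMap_eq (γ : BV a b F) (t₀ : Icc a b) :
    γ.toContinuousMap = ContinuousMap.const _ (γ t₀) + primitive F t₀ γ.deriv := by
  ext x
  simp only [toContinuousMap_apply, ContinuousMap.add_apply, ContinuousMap.const_apply,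
    primitive_apply, ← γ.apply_sub]
  abel

theorem Iic_left (ν : NAMeas a b F) : ν.toVM (Iic (left a b)) = 0 := by
  have : Iic (left a b) = {left a b} := by
    ext x
    refine ⟨fun h => le_antisymm h x.2.1, fun h => le_of_eq h⟩
  rw [this, ν.apply_singleton]

/-- The function of bounded variation with derivative `ν` and value `y` at `t₀`. -/
noncomputable def ofDeriv (t₀ : Icc a b) (y : F) (ν : NAMeas a b F) : BV a b F :=
  ⟨fun x => y + (ν.toVM (Iic x) - ν.toVM (Iic t₀)), ν, fun x => by
    simp only [Iic_left]
    abel⟩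

@[simp] theorem ofDeriv_apply (t₀ : Icc a b) (y : F) (ν : NAMeas a b F) (x : Icc a b) :
    ofDeriv t₀ y ν x = y + (ν.toVM (Iic x) - ν.toVM (Iic t₀)) := rfl

@[simp] theorem deriv_ofDeriv (t₀ : Icc a b) (y : F) (ν : NAMeas a b F) :
    (ofDeriv t₀ y ν).deriv = ν :=
  deriv_unique _ _ fun x => by
    simp only [ofDeriv_apply, Iic_left]
    abel

theorem eq_ofDeriv (γ : BV a b F) (t₀ : Icc a b) : γ = ofDeriv t₀ (γ t₀) γ.deriv :=
  toFun_injective <| funext fun x => by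
    change γ x = γ t₀ + (γ.deriv.toVM (Iic x) - γ.deriv.toVM (Iic t₀))
    rw [← γ.apply_sub]
    abel

/-- `BV.ofDeriv` with value `0` at `t₀` as a continuous linear map. -/
noncomputable def ofDerivL (F : Type*) [NormedAddCommGroup F] [NormedSpace ℝ F] (t₀ : Icc a b) :
    NAMeas a b F →L[ℝ] BV a b F :=
  LinearMap.mkContinuous
    { toFun := ofDeriv t₀ 0
      map_add' := fun ν ν' => toFun_injective <| funext fun x => by
        change (0 : F) + _ = (0 + _) + (0 + _)
        simp only [NAMeas.toVM_add, _root_.add_apply]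
        abel
      map_smul' := fun c ν => toFun_injective <| funext fun x => by
        change (0 : F) + _ = c • (0 + _)
        simp [smul_sub] } 2 fun ν => by
    -- The constant is 2 because both the value at a and the derivative contribute at most ‖ν‖.
    change ‖ofDeriv t₀ 0 ν‖ ≤ _
    rw [norm_def, deriv_ofDeriv, ofDeriv_apply, zero_add]
    have := (ν.norm_Iic_sub_le (left a b) t₀).trans (ν.variation_real_le _)
    linarith

theorem ofDeriv_eq (t₀ : Icc a b) (y : F) (ν : NAMeas a b F) :
    ofDeriv t₀ y ν = ofDeriv t₀ y 0 + ofDerivL F t₀ ν :=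
  toFun_injective <| funext fun x => by
    change y + _ = (y + _) + (0 + _)
    simp

end BV

end Operators

/-! ### The differential equation -/

section Equation

variable {E F : Type*} [NormedAddCommGroup E] [NormedSpace ℝ E]
  [NormedAddCommGroup F] [NormedSpace ℝ F]

/-! ### Restriction of measures to subintervals -/

section Restriction

variable {a b α β : ℝ}

theorem restrictTo_rfl {E : Type*} [NormedAddCommGroup E] {μ : VectorMeasure (Icc a b) E} : restrictTo Subset.rfl μ = μ := by
  refine VectorMeasure.ext fun s hs => (if_pos hs).trans ?_
  congr 1
  ext x
  simp

theorem map_restrictTo {E : Type*} [NormedAddCommGroup E] {μ : VectorMeasure (Icc a b) E}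
    (h : Icc α β ⊆ Icc a b) :
    (restrictTo h μ).map (Set.inclusion h) = μ.restrict (range (Set.inclusion h)) := by
  have hm := measurableEmbedding_incl h
  refine VectorMeasure.ext fun s hs => ?_
  rw [VectorMeasure.map_apply _ hm.measurable hs,
    VectorMeasure.restrict_apply _ hm.measurableSet_range hs, ← image_preimage_eq_inter_range]
  exact if_pos (hm.measurable hs)

instance {E : Type*} [NormedAddCommGroup E] {μ : VectorMeasure (Icc a b) E}
    (h : Icc α β ⊆ Icc a b) [IsFiniteMeasure μ.variation] :
    IsFiniteMeasure (restrictTo h μ).variation := by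
  have hm := measurableEmbedding_incl h
  constructor
  have e := hm.variation_map (μ := restrictTo h μ)
  have : (restrictTo h μ).variation univ
      = (μ.restrict (range (Set.inclusion h))).variation univ := by
    rw [← map_restrictTo h, e, Measure.map_apply hm.measurable MeasurableSet.univ, preimage_univ]
  rw [this]
  exact measure_lt_top _ _

theorem setIntegral_restrictTo {μ : VectorMeasure (Icc a b) E} (h : Icc α β ⊆ Icc a b) (A : Icc a b → E →L[ℝ] F)
    {s : Set (Icc a b)} (hs : MeasurableSet s) (hsub : s ⊆ range (Set.inclusion h)) :
    ((restrictTo h μ).restrict (Set.inclusion h ⁻¹' s)).integral (fun x => A (Set.inclusion h x))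
        (ContinuousLinearMap.id ℝ (E →L[ℝ] F))
      = (μ.restrict s).integral A (ContinuousLinearMap.id ℝ (E →L[ℝ] F)) := by
  have hm := measurableEmbedding_incl h
  rw [← hm.setIntegral_map_vectorMeasure hs, map_restrictTo,
    VectorMeasure.restrict_restrict _ hs hm.measurableSet_range, inter_eq_left.2 hsub]

end Restriction

variable {f : E → F → F} {y₀ : F} {R : ℝ} {L : ℝ≥0}

/-! ### Integral form of the equation and local uniqueness -/

section Solutions

variable {a b : ℝ}

/-- The continuous extension to `[a, b]` of `t ↦ f(·, γ t)`, for `γ` defined on `[α, β]`. -/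
noncomputable def extendTilde {α β : ℝ} [hαβ : Fact (α < β)] (f : E → F → F) {U : Set F}
    (hf : ContinuousOn (tilde f) U) (a b : ℝ) (γ : BV α β F) (hγ : ∀ t, γ t ∈ U) :
    C(Icc a b, E →L[ℝ] F) :=
  ⟨fun x => tilde f (γ (projIcc α β hαβ.out.le x)),
    hf.comp_continuous (γ.continuous.comp (continuous_projIcc.comp continuous_subtype_val))
      fun _ => hγ _⟩

/-- Integrating against μ on [a,b] allows solutions with different domains to be compared. The
integration set lies in [α,β], so the values of the extended density elsewhere do not matter. -/
theorem IsBVSolution.sub_eq_setIntegral {U : Set F} (hf : ContinuousOn (tilde f) U)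
    {μ : NAMeas a b E} {α β : ℝ} [Fact (α < β)] {h : Icc α β ⊆ Icc a b} {γ : BV α β F}
    (hγ : IsBVSolution f U μ h γ) {s t : Icc α β} (hst : s ≤ t) :
    γ t - γ s = (μ.toVM.restrict (Ioc (Set.inclusion h s) (Set.inclusion h t))).integral
      (extendTilde f hf a b γ hγ.1) (ContinuousLinearMap.id ℝ (E →L[ℝ] F)) := by
  obtain ⟨hU, hder⟩ := hγ
  let A : C(Icc α β, E →L[ℝ] F) := ⟨fun x => tilde f (γ x), hf.comp_continuous γ.continuous hU⟩
  have hA : (restrictTo h μ.toVM).Integrable (fun x => tilde f (γ x)) :=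
    integrable_of_continuous A
  have hG : ∀ x, extendTilde f hf a b γ hU (Set.inclusion h x) = tilde f (γ x) := fun x => by
    simp only [extendTilde, ContinuousMap.coe_mk, projIcc_val]
  change _ = (μ.toVM.restrict _).integral (extendTilde f hf a b γ hU) _
  generalize extendTilde f hf a b γ hU = G at hG
  rw [γ.apply_sub, ← NAMeas.apply_Ioc _ hst, hder, fStar, VectorMeasure.withDensity_apply hA,
    ← setIntegral_restrictTo h _ measurableSet_Ioc]
  · have e : Set.inclusion h ⁻¹' Ioc (Set.inclusion h s) (Set.inclusion h t) = Ioc s t := by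
      ext x
      simp
    simp only [e, hG]
  · rintro x ⟨hx1, hx2⟩
    have h1 : (s : ℝ) < x := hx1
    have h2 : (x : ℝ) ≤ t := hx2
    exact ⟨⟨x, s.2.1.trans h1.le, h2.trans t.2.2⟩, rfl⟩

/-- The integral estimate for the difference of two solutions. -/
theorem norm_sub_sub_sub_le {U : Set F} (hL : LipschitzOnWith L (tilde f) U)
    {μ : NAMeas a b E} {α₁ β₁ α₂ β₂ : ℝ} [Fact (α₁ < β₁)] [Fact (α₂ < β₂)]
    {h₁ : Icc α₁ β₁ ⊆ Icc a b} {h₂ : Icc α₂ β₂ ⊆ Icc a b} {γ₁ : BV α₁ β₁ F} {γ₂ : BV α₂ β₂ F}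
    (hγ₁ : IsBVSolution f U μ h₁ γ₁) (hγ₂ : IsBVSolution f U μ h₂ γ₂) {s t : ℝ} (hst : s ≤ t)
    (hs₁ : s ∈ Icc α₁ β₁) (hs₂ : s ∈ Icc α₂ β₂) (ht₁ : t ∈ Icc α₁ β₁) (ht₂ : t ∈ Icc α₂ β₂)
    {D : ℝ} (hD : ∀ x (_ : x ∈ Icc s t) (hx₁ : x ∈ Icc α₁ β₁) (hx₂ : x ∈ Icc α₂ β₂),
      ‖γ₁ ⟨x, hx₁⟩ - γ₂ ⟨x, hx₂⟩‖ ≤ D) :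
    ‖(γ₁ ⟨t, ht₁⟩ - γ₁ ⟨s, hs₁⟩) - (γ₂ ⟨t, ht₂⟩ - γ₂ ⟨s, hs₂⟩)‖
      ≤ L * D * μ.toVM.variation.real (Ioc ⟨s, h₁ hs₁⟩ ⟨t, h₁ ht₁⟩) := by
  have hf := hL.continuousOn
  rw [hγ₁.sub_eq_setIntegral hf (Subtype.mk_le_mk.2 hst),
    hγ₂.sub_eq_setIntegral hf (Subtype.mk_le_mk.2 hst)]
  change ‖(μ.toVM.restrict (Ioc ⟨s, h₁ hs₁⟩ ⟨t, h₁ ht₁⟩)).integral _ _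
    - (μ.toVM.restrict (Ioc ⟨s, h₁ hs₁⟩ ⟨t, h₁ ht₁⟩)).integral _ _‖ ≤ _
  rw [← VectorMeasure.integral_sub (integrable_of_continuous _) (integrable_of_continuous _)]
  have hD0 : 0 ≤ D := (norm_nonneg _).trans (hD s (left_mem_Icc.2 hst) hs₁ hs₂)
  refine (VectorMeasure.norm_setIntegral_le_of_norm_le_const (C := L * D) fun x hx => ?_).trans ?_
  · have hx1 : s < x := hx.1
    have hx2 : x ≤ t := hx.2
    have hm1 : (x : ℝ) ∈ Icc α₁ β₁ := ⟨hs₁.1.trans hx1.le, hx2.trans ht₁.2⟩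
    have hm2 : (x : ℝ) ∈ Icc α₂ β₂ := ⟨hs₂.1.trans hx1.le, hx2.trans ht₂.2⟩
    simp only [Pi.sub_apply, extendTilde, ContinuousMap.coe_mk]
    rw [projIcc_of_mem _ hm1, projIcc_of_mem _ hm2]
    refine (hL.norm_sub_le (hγ₁.1 _) (hγ₂.1 _)).trans ?_
    gcongr
    exact hD x ⟨hx1.le, hx2⟩ hm1 hm2
  · have h1 : ‖ContinuousLinearMap.id ℝ (E →L[ℝ] F)‖ ≤ 1 := ContinuousLinearMap.norm_id_le
    calc _ ≤ L * D * 1 * μ.toVM.variation.real (Ioc ⟨s, h₁ hs₁⟩ ⟨t, h₁ ht₁⟩) := by gcongr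
      _ = _ := by rw [mul_one]

theorem locallyUniqueBVSolutions {U : Set F} (hL : LipschitzOnWith L (tilde f) U)
    (μ : NAMeas a b E) : LocallyUniqueBVSolutions f U μ := by
  intro α₁ β₁ α₂ β₂ hαβ₁ hαβ₂ h₁ h₂ γ₁ γ₂ hγ₁ hγ₂ t₀ ht₁ ht₂ heq
  -- The bound 1/(L + 1) makes sense also for L = 0, and L/(L + 1) < 1.
  obtain ⟨δ, hδ, hm⟩ := exists_measureReal_closedBall_lt _
    (μ.variation_singleton ⟨t₀, h₁ ht₁⟩) (ε := ((L : ℝ) + 1)⁻¹) (by positivity)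
  refine ⟨Icc (t₀ - δ) (t₀ + δ),
    mem_nhdsWithin_of_mem_nhds (Icc_mem_nhds (by linarith) (by linarith)), ?_⟩
  set K := Icc α₁ β₁ ∩ Icc α₂ β₂ ∩ Icc (t₀ - δ) (t₀ + δ) with hK
  have hKc : IsCompact K := ((isCompact_Icc.inter isCompact_Icc).inter isCompact_Icc)
  have hKo : OrdConnected K := (ordConnected_Icc.inter ordConnected_Icc).inter ordConnected_Icc
  have ht₀ : t₀ ∈ K := ⟨⟨ht₁, ht₂⟩, by linarith, by linarith⟩
  let d : ℝ → ℝ := fun t => ‖γ₁ (projIcc α₁ β₁ hαβ₁.out.le t) - γ₂ (projIcc α₂ β₂ hαβ₂.out.le t)‖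
  have hd : Continuous d :=
    ((γ₁.continuous.comp continuous_projIcc).sub (γ₂.continuous.comp continuous_projIcc)).norm
  have hdeq : ∀ x (hx₁ : x ∈ Icc α₁ β₁) (hx₂ : x ∈ Icc α₂ β₂),
      d x = ‖γ₁ ⟨x, hx₁⟩ - γ₂ ⟨x, hx₂⟩‖ := by
    intro x hx₁ hx₂
    simp only [d, projIcc_of_mem _ hx₁, projIcc_of_mem _ hx₂]
  -- At a point of maximal distance D on K, the integral estimate between t₀ and t gives D ≤ LD/(L +
  -- 1), hence D = 0. Order-connectedness of K keeps the whole interval between them inside K.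
  obtain ⟨t, htK, htmax⟩ := hKc.exists_isMaxOn ⟨t₀, ht₀⟩ hd.continuousOn
  have hest : ∀ s t' : ℝ, s ∈ K → t' ∈ K → s ≤ t' → ∀ (hs₁ : s ∈ Icc α₁ β₁) (hs₂ : s ∈ Icc α₂ β₂)
      (ht₁ : t' ∈ Icc α₁ β₁) (ht₂ : t' ∈ Icc α₂ β₂),
      ‖(γ₁ ⟨t', ht₁⟩ - γ₁ ⟨s, hs₁⟩) - (γ₂ ⟨t', ht₂⟩ - γ₂ ⟨s, hs₂⟩)‖
        ≤ L * d t * ((L : ℝ) + 1)⁻¹ := by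
    intro s t' hsK htK' hst hs₁ hs₂ ht₁' ht₂'
    refine (norm_sub_sub_sub_le hL hγ₁ hγ₂ hst hs₁ hs₂ ht₁' ht₂' (D := d t)
      fun x hx hx₁ hx₂ => ?_).trans ?_
    · rw [← hdeq x hx₁ hx₂]
      exact htmax (hKo.out hsK htK' hx)
    · have : μ.toVM.variation.real (Ioc ⟨s, h₁ hs₁⟩ ⟨t', h₁ ht₁'⟩) ≤ ((L : ℝ) + 1)⁻¹ := by
        refine (measureReal_mono fun x hx => ?_).trans hm.le
        have hx1 : s < x := hx.1
        have hx2 : x ≤ t' := hx.2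
        rw [Metric.mem_closedBall, Subtype.dist_eq, Real.dist_eq, abs_le]
        have h3 := hsK.2.1
        have h4 := htK'.2.2
        constructor <;> simp only <;> linarith
      have : 0 ≤ d t := norm_nonneg _
      gcongr
  have hle : d t ≤ L * d t * ((L : ℝ) + 1)⁻¹ := by
    rw [hdeq t htK.1.1 htK.1.2]
    rw [hdeq t htK.1.1 htK.1.2] at hest
    rcases le_total t₀ t with h | h
    · have := hest t₀ t ht₀ htK h ht₁ ht₂ htK.1.1 htK.1.2
      rw [heq, sub_sub_sub_cancel_right] at this
      exact this
    · have := hest t t₀ htK ht₀ h htK.1.1 htK.1.2 ht₁ ht₂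
      rw [heq, sub_sub_sub_cancel_left, norm_sub_rev] at this
      exact this
  have hd0 : d t = 0 := by
    have hnn : 0 ≤ d t := norm_nonneg _
    have hpos : (0 : ℝ) < L + 1 := by positivity
    rw [← div_eq_mul_inv, le_div_iff₀ hpos] at hle
    linarith
  intro x hx₁ hx₂ hxK
  have := htmax (show x ∈ K from ⟨⟨hx₁, hx₂⟩, hxK⟩)
  have h0 : d x ≤ 0 := by
    rw [← hd0]; exact this
  rw [hdeq x hx₁ hx₂] at h0
  exact sub_eq_zero.1 (norm_le_zero_iff.1 h0)

variable [Fact (a < b)] [CompleteSpace E] [CompleteSpace F]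

theorem isBVSolution_rfl_iff {U : Set F} (hf : ContinuousOn (tilde f) U) {μ : NAMeas a b E}
    {γ : BV a b F} : IsBVSolution f U μ Subset.rfl γ ↔ (∀ t, γ t ∈ U) ∧
      γ.deriv = NAMeas.withDensity (superpos (Icc a b) (tilde f) γ.toContinuousMap) μ := by
  refine and_congr_right fun hγ => ?_
  have e : (superpos (Icc a b) (tilde f) γ.toContinuousMap : Icc a b → E →L[ℝ] F)
      = fun t => tilde f (γ t) := funext fun t => superpos_apply hf (γ := γ.toContinuousMap) hγ t
  rw [restrictTo_rfl, ← NAMeas.toVM_injective.eq_iff, NAMeas.toVM_withDensity, e]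
  rfl

end Solutions

/-! ### The Picard operator: existence and dependence on the measure -/

section Picard

variable {a b : ℝ}

theorem bddAbove_norm_tilde (hL : LipschitzOnWith L (tilde f) (Metric.ball y₀ R)) (hR : 0 < R) :
    BddAbove ((fun y => ‖tilde f y‖) '' Metric.ball y₀ R) := by
  refine ⟨‖tilde f y₀‖ + L * R, ?_⟩
  rintro _ ⟨y, hy, rfl⟩
  have h1 := hL.norm_sub_le hy (Metric.mem_ball_self hR)
  have h2 : ‖y - y₀‖ ≤ R := by
    rw [← dist_eq_norm]
    exact (Metric.mem_ball.1 hy).le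
  have h3 : (L : ℝ) * ‖y - y₀‖ ≤ L * R := by gcongr
  have h4 := norm_sub_norm_le (tilde f y) (tilde f y₀)
  simp only
  linarith

theorem norm_tilde_le_tildeSup (hL : LipschitzOnWith L (tilde f) (Metric.ball y₀ R)) (hR : 0 < R)
    {y : F} (hy : y ∈ Metric.ball y₀ R) : ‖tilde f y‖ ≤ tildeSup f (Metric.ball y₀ R) :=
  le_csSup (bddAbove_norm_tilde hL hR) ⟨y, hy, rfl⟩

theorem tildeSup_nonneg (f : E → F → F) (U : Set F) : 0 ≤ tildeSup f U :=
  Real.sSup_nonneg (by rintro _ ⟨y, -, rfl⟩; exact norm_nonneg _)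

theorem norm_superpos_sub_le {U : Set F} (hL : LipschitzOnWith L (tilde f) U)
    {γ γ' : C(Icc a b, F)} (hγ : γ ∈ valuedIn (Icc a b) U) (hγ' : γ' ∈ valuedIn (Icc a b) U) :
    ‖superpos (Icc a b) (tilde f) γ - superpos (Icc a b) (tilde f) γ'‖ ≤ L * ‖γ - γ'‖ := by
  refine (ContinuousMap.norm_le _ (by positivity)).2 fun t => ?_
  rw [ContinuousMap.sub_apply, superpos_apply hL.continuousOn hγ, superpos_apply hL.continuousOn hγ']
  refine (hL.norm_sub_le (hγ t) (hγ' t)).trans ?_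
  gcongr
  exact (γ - γ').norm_coe_le_norm t

theorem smallMeasures_convex_isOpen_zero_mem (hR : 0 < R) :
    Convex ℝ (smallMeasures (E := E) a b f y₀ R L) ∧
      IsOpen (smallMeasures (E := E) a b f y₀ R L) ∧
      (0 : NAMeas a b E) ∈ smallMeasures a b f y₀ R L := by
  refine ⟨?_, ?_, by simp [smallMeasures, hR]⟩
  · have hconv : ∀ (c : ℝ) (r : ℝ), 0 ≤ c → Convex ℝ {μ : NAMeas a b E | c * ‖μ‖ < r} := by
      intro c r hc
      have := ((convexOn_univ_norm (E := NAMeas a b E)).smul hc).convex_lt r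
      simpa using this
    exact (hconv _ R (tildeSup_nonneg _ _)).inter (hconv L 1 L.2)
  · have hopen : ∀ c r : ℝ, IsOpen {μ : NAMeas a b E | c * ‖μ‖ < r} := fun c r =>
      isOpen_lt (by fun_prop) continuous_const
    exact (hopen _ R).inter (hopen L 1)

variable [CompleteSpace E] [CompleteSpace F]

/-- The Picard operator of the integral equation. -/
noncomputable def picard (f : E → F → F) (y₀ : F) (t₀ : Icc a b)
    (p : NAMeas a b E × C(Icc a b, F)) : C(Icc a b, F) :=
  ContinuousMap.const _ y₀
    + primitive F t₀ (NAMeas.withDensity (superpos (Icc a b) (tilde f) p.2) p.1)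

theorem norm_picard_sub_le {U : Set F} (hL : LipschitzOnWith L (tilde f) U) (t₀ : Icc a b)
    (μ : NAMeas a b E) {γ γ' : C(Icc a b, F)} (hγ : γ ∈ valuedIn (Icc a b) U)
    (hγ' : γ' ∈ valuedIn (Icc a b) U) :
    ‖picard f y₀ t₀ (μ, γ) - picard f y₀ t₀ (μ, γ')‖ ≤ L * ‖μ‖ * ‖γ - γ'‖ := by
  have e := NAMeas.isBoundedBilinearMap_withDensity (E := E) (F := F) (a := a) (b := b)
  simp only [picard, add_sub_add_left_eq_sub, ← map_sub]
  refine (norm_primitive_apply_le t₀ _).trans ?_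
  rw [← e.map_sub_left]
  refine (NAMeas.norm_withDensity_le _ μ).trans ?_
  have := norm_superpos_sub_le hL hγ hγ'
  calc _ ≤ (L * ‖γ - γ'‖) * ‖μ‖ := by gcongr
    _ = _ := by ring

theorem norm_picard_sub_const_le (hL : LipschitzOnWith L (tilde f) (Metric.ball y₀ R)) (hR : 0 < R)
    (t₀ : Icc a b) (μ : NAMeas a b E) {γ : C(Icc a b, F)}
    (hγ : γ ∈ valuedIn (Icc a b) (Metric.ball y₀ R)) :
    ‖picard f y₀ t₀ (μ, γ) - ContinuousMap.const _ y₀‖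
      ≤ tildeSup f (Metric.ball y₀ R) * ‖μ‖ := by
  simp only [picard, add_sub_cancel_left]
  refine (norm_primitive_apply_le t₀ _).trans ((NAMeas.norm_withDensity_le _ μ).trans ?_)
  gcongr
  refine (ContinuousMap.norm_le _ (tildeSup_nonneg _ _)).2 fun t => ?_
  rw [superpos_apply hL.continuousOn hγ]
  exact norm_tilde_le_tildeSup hL hR (hγ t)

theorem bastianiC_withDensity_superpos {k : ℕ} {U : Set F} (hU : IsOpen U)
    (hf : BastianiC k U (tilde f)) {P : Type*} [NormedAddCommGroup P] [NormedSpace ℝ P]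
    {Q : Set P} (hQ : IsOpen Q) {m : P → NAMeas a b E} {g : P → C(Icc a b, F)}
    (hm : BastianiC k Q m) (hg : BastianiC k Q g) (hgU : MapsTo g Q (valuedIn (Icc a b) U)) :
    BastianiC k Q fun p => NAMeas.withDensity (superpos (Icc a b) (tilde f) (g p)) (m p) :=
  BastianiC.contDiff_comp hQ NAMeas.isBoundedBilinearMap_withDensity.contDiff
    ((BastianiC.comp hQ (isOpen_valuedIn hU) (hf.superpos hU) hg hgU).prodMk hm)

variable [Fact (a < b)]

theorem exists_isBVSolution (hL : LipschitzOnWith L (tilde f) (Metric.ball y₀ R)) (hR : 0 < R)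
    (μ : NAMeas a b E) (h1 : (L : ℝ) * ‖μ‖ < 1) (h2 : tildeSup f (Metric.ball y₀ R) * ‖μ‖ < R)
    (t₀ : Icc a b) :
    ∃ η : BV a b F, IsBVSolution f (Metric.ball y₀ R) μ Subset.rfl η ∧ η t₀ = y₀ := by
  set c : C(Icc a b, F) := ContinuousMap.const _ y₀ with hc
  -- Since r < R, the closed ball of radius r about the constant y₀ is complete, consists of
  -- functions with values in the open ball, and is mapped into itself.
  set r := tildeSup f (Metric.ball y₀ R) * ‖μ‖ with hr
  have hr0 : 0 ≤ r := mul_nonneg (tildeSup_nonneg _ _) (norm_nonneg _)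
  have hball : Metric.closedBall c r ⊆ valuedIn (Icc a b) (Metric.ball y₀ R) := by
    intro γ hγ t
    exact ((ContinuousMap.dist_apply_le_dist t).trans hγ).trans_lt h2
  have hmaps : MapsTo (fun γ => picard f y₀ t₀ (μ, γ)) (Metric.closedBall c r)
      (Metric.closedBall c r) := fun γ hγ => by
    rw [mem_closedBall_iff_norm]
    exact norm_picard_sub_const_le hL hR t₀ μ (hball hγ)
  have hcontr : ContractingWith (L * ‖μ‖₊) (hmaps.restrict _ _ _) := by
    refine ⟨by exact_mod_cast h1, LipschitzWith.of_dist_le_mul fun γ γ' => ?_⟩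
    rw [Subtype.dist_eq, Subtype.dist_eq, dist_eq_norm, dist_eq_norm]
    exact norm_picard_sub_le hL t₀ μ (hball γ.2) (hball γ'.2)
  obtain ⟨γ, hγ, hfix, -⟩ := hcontr.exists_fixedPoint' Metric.isClosed_closedBall.isComplete hmaps
    (Metric.mem_closedBall_self hr0) (edist_ne_top _ _)
  have hfix : picard f y₀ t₀ (μ, γ) = γ := hfix
  refine ⟨BV.ofDeriv t₀ y₀ (NAMeas.withDensity (superpos (Icc a b) (tilde f) γ) μ), ?_, by simp⟩
  have e : (BV.ofDeriv t₀ y₀ (NAMeas.withDensity (superpos (Icc a b) (tilde f) γ) μ)).toContinuousMap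
      = γ := by
    refine Eq.trans ?_ hfix
    ext x
    rfl
  rw [isBVSolution_rfl_iff hL.continuousOn, e, BV.deriv_ofDeriv]
  refine ⟨fun t => ?_, rfl⟩
  rw [← BV.toContinuousMap_apply, e]
  exact hball hγ t

theorem bastianiC_solution (hL : LipschitzOnWith L (tilde f) (Metric.ball y₀ R)) {k : ℕ}
    (hf : BastianiC k (Metric.ball y₀ R) (tilde f))
    (hQ : IsOpen (smallMeasures (E := E) a b f y₀ R L)) (t₀ : Icc a b)
    (η : NAMeas a b E → BV a b F)
    (hη : ∀ μ ∈ smallMeasures a b f y₀ R L,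
      IsBVSolution f (Metric.ball y₀ R) μ Subset.rfl (η μ) ∧ η μ t₀ = y₀) :
    BastianiC k (smallMeasures a b f y₀ R L) η := by
  set Q := smallMeasures (E := E) a b f y₀ R L with hQdef
  have hB : IsOpen (Metric.ball y₀ R) := Metric.isOpen_ball
  have hsol : ∀ μ ∈ Q, (η μ).toContinuousMap ∈ valuedIn (Icc a b) (Metric.ball y₀ R) ∧
      (η μ).deriv = NAMeas.withDensity (superpos (Icc a b) (tilde f) (η μ).toContinuousMap) μ :=
    fun μ hμ => (isBVSolution_rfl_iff hL.continuousOn).1 (hη μ hμ).1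
  have hO : IsOpen (Q ×ˢ valuedIn (Icc a b) (Metric.ball y₀ R)) := hQ.prod (isOpen_valuedIn hB)
  have hpic : BastianiC k (Q ×ˢ valuedIn (Icc a b) (Metric.ball y₀ R)) (picard f y₀ t₀) :=
    BastianiC.contDiff_comp hO (g := fun ν => ContinuousMap.const _ y₀ + primitive F t₀ ν)
      (contDiff_const.add (primitive F t₀).contDiff)
      (bastianiC_withDensity_superpos hB hf hO (BastianiC.of_contDiff contDiff_fst _)
        (BastianiC.of_contDiff contDiff_snd _) fun p hp => hp.2)
  -- First stage, with values in C([a,b],F): the given solutions are fixed points of the Picard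
  -- operator, with contraction constant L‖μ‖ < 1 on Q.
  have hγ : BastianiC k Q fun μ => (η μ).toContinuousMap := by
    refine BastianiC.fixedPoint hQ (isOpen_valuedIn hB) hpic (θ := fun μ => L * ‖μ‖) (by fun_prop)
      (fun μ => by positivity) (fun μ hμ => hμ.2)
      (fun μ _ z hz z' hz' => norm_picard_sub_le hL t₀ μ hz hz') (fun μ hμ => (hsol μ hμ).1)
      fun μ hμ => ?_
    have e := (η μ).toContinuousMap_eq t₀
    rw [(hη μ hμ).2] at e
    exact (congrArg (fun ν => ContinuousMap.const _ y₀ + primitive F t₀ ν)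
      (hsol μ hμ).2.symm).trans e.symm
  -- Second stage: η μ is a continuous affine image of its derivative f_*(μ, η μ), which depends on
  -- η μ only as a continuous function. This recovers the `BV`-norm without losing an order.
  have hder : BastianiC k Q fun μ => BV.ofDeriv t₀ y₀ 0 + BV.ofDerivL F t₀
      (NAMeas.withDensity (superpos (Icc a b) (tilde f) (η μ).toContinuousMap) μ) :=
    BastianiC.contDiff_comp hQ (g := fun ν => BV.ofDeriv t₀ y₀ 0 + BV.ofDerivL F t₀ ν)
      (contDiff_const.add (BV.ofDerivL F t₀).contDiff)
      (bastianiC_withDensity_superpos hB hf hQ (BastianiC.of_contDiff contDiff_id _) hγ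
        fun μ hμ => (hsol μ hμ).1)
  refine hder.congr hQ fun μ hμ => ?_
  rw [← (hsol μ hμ).2, ← BV.ofDeriv_eq, ← (hη μ hμ).2]
  exact (η μ).eq_ofDeriv t₀

end Picard

end Equation

end BVODE

theorem mainTheorem10 {E F : Type*}
    [NormedAddCommGroup E] [NormedSpace ℝ E] [CompleteSpace E]
    [NormedAddCommGroup F] [NormedSpace ℝ F] [CompleteSpace F]
    (y₀ : F) (R : ℝ) (hR : 0 < R) (f : E → F → F)
    (hf : ∀ y ∈ Metric.ball y₀ R,
      IsLinearMap ℝ (fun x => f x y) ∧ Continuous (fun x => f x y))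
    (L : ℝ≥0) (hL : LipschitzOnWith L (tilde f) (Metric.ball y₀ R)) :
    -- local uniqueness
    (∀ (a b : ℝ) [Fact (a < b)] (μ : NAMeas a b E),
      LocallyUniqueBVSolutions f (Metric.ball y₀ R) μ) ∧
    -- global existence for small measures
    (∀ (a b : ℝ) [Fact (a < b)] (μ : NAMeas a b E), (L : ℝ) * ‖μ‖ < 1 →
      tildeSup f (Metric.ball y₀ R) * ‖μ‖ < R →
      ∀ t₀ : Set.Icc a b, ∃ η : BV a b F,
        IsBVSolution f (Metric.ball y₀ R) μ Set.Subset.rfl η ∧ η t₀ = y₀) ∧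
    -- dependence of the solution on the measure
    (∀ (a b : ℝ) [Fact (a < b)],
      (Convex ℝ (smallMeasures (E := E) a b f y₀ R L) ∧
        IsOpen (smallMeasures (E := E) a b f y₀ R L) ∧
        (0 : NAMeas a b E) ∈ smallMeasures a b f y₀ R L) ∧
      ∀ k : ℕ∞, IsBastianiC k (Metric.ball y₀ R) (tilde f) →
        ∀ (t₀ : Set.Icc a b) (η : NAMeas a b E → BV a b F),
          (∀ μ ∈ smallMeasures a b f y₀ R L,
            IsBVSolution f (Metric.ball y₀ R) μ Set.Subset.rfl (η μ) ∧ η μ t₀ = y₀) →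
          IsBastianiC k (smallMeasures a b f y₀ R L) η) := by
  refine ⟨fun a b _ μ => locallyUniqueBVSolutions hL μ,
    fun a b _ μ h1 h2 t₀ => exists_isBVSolution hL hR μ h1 h2 t₀,
    fun a b _ => ⟨smallMeasures_convex_isOpen_zero_mem hR, fun k hk t₀ η hη => ?_⟩⟩
  have hQ := (smallMeasures_convex_isOpen_zero_mem (E := E) (a := a) (b := b) (f := f) (y₀ := y₀)
    (L := L) hR).2.1
  exact BastianiC.isBastianiC hQ fun n hn =>
    bastianiC_solution hL (hk.bastianiC Metric.isOpen_ball hn) hQ t₀ η hη
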